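/- Let $p$ be a prime, $n\ge 1$, and write $\mathbb{C}_p$ for the completion of the algebraic closure of $\mathbb{Q}_p$ and $\mathrm{ord}_p$ for its valuation with $\mathrm{ord}_p(p)=1$, applied coordinatewise to vectors in $(\mathbb{C}_p^*)^n$. For a system $F=(f_1,\dots,f_n)$ of Laurent polynomials in $\mathbb{C}_p[x_1^{\pm1},\dots,x_n^{\pm1}]$ let $Z^*(F)$ be its set of roots in $(\mathbb{C}_p^*)^n$. Call $F$ *tropically generic* if the closures in $\mathbb{R}^n$ of $\mathrm{ord}_p(Z^*(f_1)),\dots,\mathrm{ord}_p(Z^*(f_n))$ intersect transversally, i.e. near every common point each of these sets agrees with an affine subspace, and the codimensions of these subspaces add up to the codimension of their intersection. For finite sets $A_1,\dots,A_n\subset\mathbb{Z}^n$ let $\overline{\mathcal V}_p(A_1,\dots,A_n)$ be the maximum of $\#\,\mathrm{ord}_p(Z^*(F))$ over all $F$ such that $\mathrm{Supp}(f_i)\subseteq A_i$ for all $i$ and $Z^*(F)$ is finite, and let $\mathcal V_p(A_1,\dots,A_n)$ be the maximum over those $F$ that are moreover tropically generic (a maximum over the empty family is $0$). Put $A:=\bigcup_i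 A_i$ and $t:=\#A$; let $\mathbf O$ be the origin and $e_i$ the $i$-th standard basis vector. Then: (0) If $t\le n$, then $\mathcal V_p(A_1,\dots,A_n)=\overline{\mathcal V}_p(A_1,\dots,A_n)=0$. (1) If $t=n+1$, then $\mathcal V_p(A_1,\dots,A_n)=\overline{\mathcal V}_p(A_1,\dots,A_n)\le 1$. Moreover $\mathcal V_p(\{\mathbf O,e_1\},\dots,\{\mathbf O,e_n\})=1$. (2) Suppose $t=n+2$ and $A$ is in general position in the following sense: whenever $\{u_1,v_1\},\dots,\{u_n,v_n\}$ are $n$ distinct pairs of distinct points of $A$ which, viewed as edges of a graph on $A$, contain no cycle, the vectors $u_1-v_1,\dots,u_n-v_n$ are linearly independent. Then $\overline{\mathcal V}_p(A_1,\dots,A_n)\le\max\{2,\lfloor n/2\rfloor^n+n\}$. Moreover (with no hypothesis on $A$) $$\mathcal V_p\big(\{\mathbf O,2e_1,e_1+e_2\},\{\mathbf O,2e_1,e_2+e_3\},\dots,\{\mathbf O,2e_1,e_{n-1}+e_n\},\{\mathbf O,2e_1,e_n\}\big)=n+1.$$ -/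

import Mathlib

open scoped Topology

noncomputable section

/-- Laurent polynomials over `ℂ_p` in `n` variables: finitely supported families of coefficients
indexed by exponent vectors in `ℤ^n`. -/
abbrev LaurentPoly (p : ℕ) [Fact p.Prime] (n : ℕ) : Type :=
  AddMonoidAlgebra ℂ_[p] (Fin n → ℤ)

/-- `Supp(f)`: the set of exponent vectors of the monomials occurring in `f`. -/
def LaurentPoly.supp {p : ℕ} [Fact p.Prime] {n : ℕ} (f : LaurentPoly p n) :
    Set (Fin n → ℤ) :=
  {a | f.coeff a ≠ 0}

/-- The value `∑_a c_a x^a` of a Laurent polynomial (used at points with nonzero coordinates). -/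
def LaurentPoly.evalAt {p : ℕ} [Fact p.Prime] {n : ℕ} (f : LaurentPoly p n)
    (x : Fin n → ℂ_[p]) : ℂ_[p] :=
  f.coeff.sum fun a c => c * ∏ i, x i ^ a i

/-- `Z^*(f_1, …, f_r)`: the common roots all of whose coordinates are nonzero. -/
def torusZeros {p : ℕ} [Fact p.Prime] {n : ℕ} {ι : Type} (F : ι → LaurentPoly p n) :
    Set (Fin n → ℂ_[p]) :=
  {x | (∀ j, x j ≠ 0) ∧ ∀ i, (F i).evalAt x = 0}

/-- The valuation `ord_p` on `ℂ_p \ {0}`, normalized by `|x|_p = p ^ (-ord_p x)`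
(so that `ord_p p = 1`). -/
def ordC (p : ℕ) [Fact p.Prime] (x : ℂ_[p]) : ℝ :=
  -Real.logb p ‖x‖

/-- `ord_p` applied coordinatewise. -/
def ordVec {p : ℕ} [Fact p.Prime] {n : ℕ} (x : Fin n → ℂ_[p]) : Fin n → ℝ :=
  fun i => ordC p (x i)

/-- The set `ord_p(Z^*(F))` of valuation vectors of the roots of `F`. -/
def valuationVectors {p : ℕ} [Fact p.Prime] {n : ℕ} {ι : Type} (F : ι → LaurentPoly p n) :
    Set (Fin n → ℝ) :=
  ordVec '' torusZeros F

/-- The closure of `ord_p(Z^*(f))` in `ℝ^n`, for a single Laurent polynomial `f`. -/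
def tropicalSet {p : ℕ} [Fact p.Prime] {n : ℕ} (f : LaurentPoly p n) : Set (Fin n → ℝ) :=
  closure (valuationVectors (fun _ : Unit => f))

/-- Polyhedral sets `T_1, …, T_n ⊆ ℝ^n` intersect transversally if, at each common point `w`,
every `T_i` agrees near `w` with an affine subspace `w + V_i`, and the codimensions of the `V_i`
add up to the codimension of their intersection. For `n` polyhedral complexes of codimension one
this says that `w` lies in the relative interior of a maximal cell of each of them and that the
hyperplanes spanned by these cells have linearly independent normals. -/
def IntersectTransversally {n : ℕ} (T : Fin n → Set (Fin n → ℝ)) : Prop :=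
  ∀ w : Fin n → ℝ, (∀ i, w ∈ T i) →
    ∃ V : Fin n → Submodule ℝ (Fin n → ℝ),
      (∀ i, ∀ᶠ x in 𝓝 w, x ∈ T i ↔ x - w ∈ V i) ∧
      ∑ i, Module.finrank ℝ ((Fin n → ℝ) ⧸ V i) =
        Module.finrank ℝ ((Fin n → ℝ) ⧸ (⨅ i, V i))

/-- `F = (f_1, …, f_n)` is tropically generic over `ℂ_p`. -/
def TropicallyGeneric {p : ℕ} [Fact p.Prime] {n : ℕ} (F : Fin n → LaurentPoly p n) : Prop :=
  IntersectTransversally fun i => tropicalSet (F i)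

/-- The systems `F = (f_1, …, f_n)` over `ℂ_p` with `Supp(f_i) ⊆ A_i` for all `i` and with
`Z^*(F)` finite. -/
def sparseSystems (p : ℕ) [Fact p.Prime] {n : ℕ} (A : Fin n → Finset (Fin n → ℤ)) :
    Set (Fin n → LaurentPoly p n) :=
  {F | (∀ i, (F i).supp ⊆ (A i : Set (Fin n → ℤ))) ∧ (torusZeros F).Finite}

/-- The maximal number of valuation vectors over all `F` supported on `(A_1, …, A_n)` with
`Z^*(F)` finite (as a supremum in `ℕ ∪ {∞}`). -/
def maxValuations (p : ℕ) [Fact p.Prime] {n : ℕ} (A : Fin n → Finset (Fin n → ℤ)) : ℕ∞ :=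
  ⨆ F ∈ sparseSystems p A, (valuationVectors F).encard

/-- The analogue of `maxValuations` where `F` is moreover tropically generic. -/
def maxGenericValuations (p : ℕ) [Fact p.Prime] {n : ℕ} (A : Fin n → Finset (Fin n → ℤ)) : ℕ∞ :=
  ⨆ F ∈ {F ∈ sparseSystems p A | TropicallyGeneric F}, (valuationVectors F).encard

/-- The general position condition on a finite set `S ⊆ ℤ^n`: any `n` distinct pairs `{u_k, v_k}`
of points of `S` containing no cycle (that is, forming the edges of a forest) determine linearly
independent vectors `u_k - v_k`. Pairs forming a cycle have linearly dependent differences for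
every `S`. -/
def InGeneralPosition {n : ℕ} (S : Finset (Fin n → ℤ)) : Prop :=
  ∀ u v : Fin n → (Fin n → ℤ),
    (∀ k, u k ∈ S) → (∀ k, v k ∈ S) → (∀ k, u k ≠ v k) →
    Function.Injective (fun k => s(u k, v k)) →
    (SimpleGraph.fromEdgeSet (Set.range fun k => s(u k, v k))).IsAcyclic →
    LinearIndependent ℝ (fun k (i : Fin n) => ((u k i - v k i : ℤ) : ℝ))

/-- The supports `{O, e_1}, …, {O, e_n}`. -/
def coordinateSupports (n : ℕ) : Fin n → Finset (Fin n → ℤ) :=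
  fun i => {0, Pi.single i 1}

/-- The supports `{O, 2e_1, e_1 + e_2}, …, {O, 2e_1, e_{n-1} + e_n}, {O, 2e_1, e_n}`. -/
def chainSupports (n : ℕ) : Fin n → Finset (Fin n → ℤ) :=
  fun i => {0, Pi.single ⟨0, i.pos⟩ 2,
    Pi.single i 1 + if h : i.val + 1 < n then Pi.single ⟨i.val + 1, h⟩ 1 else 0}

end

/-! ### Isolated zeros of polynomial systems -/

namespace MvPolynomial

variable {K σ : Type*} [Field K]

/-- The translation `X ↦ X + c` of a polynomial ring. -/
noncomputable def translate (c : σ → K) : MvPolynomial σ K ≃ₐ[K] MvPolynomial σ K :=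
  AlgEquiv.ofAlgHom (aeval fun i => X i + C (c i)) (aeval fun i => X i - C (c i))
    (by ext i; simp [algebraMap_eq]) (by ext i; simp [algebraMap_eq])

lemma aeval_translate (c x : σ → K) (g : MvPolynomial σ K) :
    aeval x (translate c g) = aeval (x + c) g := by
  have : (aeval x).comp (translate c : MvPolynomial σ K →ₐ[K] MvPolynomial σ K) =
      aeval (R := K) (x + c) := by
    ext i; simp [translate]
  exact DFunLike.congr_fun this g

lemma height_vanishingIdeal_singleton_eq (x y : σ → K) :
    (vanishingIdeal K {x} : Ideal (MvPolynomial σ K)).height =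
      (vanishingIdeal K {y} : Ideal (MvPolynomial σ K)).height := by
  have : (vanishingIdeal K {y} : Ideal (MvPolynomial σ K)) =
      (vanishingIdeal K {x} : Ideal (MvPolynomial σ K)).comap
        (translate (x - y)).symm.toRingEquiv := by
    ext g
    have h := aeval_translate (x - y) y ((translate (x - y)).symm g)
    rw [AlgEquiv.apply_symm_apply, add_sub_cancel] at h
    rw [Ideal.mem_comap, mem_vanishingIdeal_singleton_iff]
    change _ ↔ (translate (x - y)).symm g ∈ vanishingIdeal K {x}
    rw [mem_vanishingIdeal_singleton_iff, h]
  rw [this, RingEquiv.height_comap]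

lemma card_le_height_vanishingIdeal_singleton [IsAlgClosed K] [Fintype σ] (x : σ → K) :
    (Fintype.card σ : ℕ∞) ≤ (vanishingIdeal K {x} : Ideal (MvPolynomial σ K)).height := by
  have h : ringKrullDim (MvPolynomial σ K) ≤
      ((vanishingIdeal K {x} : Ideal (MvPolynomial σ K)).height : WithBot ℕ∞) := by
    rw [ringKrullDim_le_iff_isMaximal_height_le]
    intro I hI
    obtain ⟨y, rfl⟩ := isMaximal_iff_eq_vanishingIdeal_singleton.1 hI
    rw [height_vanishingIdeal_singleton_eq y x]
  rw [ringKrullDim_of_isNoetherianRing, ringKrullDim_eq_zero_of_field, zero_add,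
    Nat.card_eq_fintype_card] at h
  exact_mod_cast h

/-- A system of polynomials which, on the complement of a hypersurface, has a nonempty finite set
of zeros consists of at least as many polynomials as there are variables. -/
theorem card_le_of_finite_zeros [IsAlgClosed K] [Fintype σ] (S : Finset (MvPolynomial σ K))
    (h : MvPolynomial σ K) (hfin : {x : σ → K | (∀ g ∈ S, aeval x g = 0) ∧ aeval x h ≠ 0}.Finite)
    {x₀ : σ → K} (hx₀ : ∀ g ∈ S, aeval x₀ g = 0) (hh : aeval x₀ h ≠ 0) :
    Fintype.card σ ≤ S.card := by
  classical
  set m : Ideal (MvPolynomial σ K) := vanishingIdeal K {x₀} with hm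
  have hle : Ideal.span (S : Set (MvPolynomial σ K)) ≤ m :=
    Ideal.span_le.2 fun g hg => mem_vanishingIdeal_singleton_iff x₀ g |>.2 (hx₀ g hg)
  have hmin : m ∈ (Ideal.span (S : Set (MvPolynomial σ K))).minimalPrimes := by
    refine ⟨⟨inferInstance, hle⟩, ?_⟩
    rintro P ⟨hP, hSP⟩ hPm
    have hex : ∀ z : σ → K, ∃ q : MvPolynomial σ K, aeval x₀ q ≠ 0 ∧ (z ≠ x₀ → aeval z q = 0) := by
      intro z
      by_cases hz : z = x₀
      · exact ⟨1, by simp, fun h => absurd hz h⟩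
      · obtain ⟨i, hi⟩ := Function.ne_iff.1 hz
        exact ⟨X i - C (z i), by simpa [sub_eq_zero, algebraMap_eq] using Ne.symm hi, by simp⟩
    choose q hq0 hq using hex
    set Q := h * ∏ z ∈ hfin.toFinset, q z with hQ
    have hQ0 : aeval x₀ Q ≠ 0 := by
      rw [hQ, map_mul, map_prod]
      exact mul_ne_zero hh (Finset.prod_ne_zero_iff.2 fun z _ => hq0 z)
    have hQP : Q ∉ P := fun hQ' => hQ0 ((mem_vanishingIdeal_singleton_iff x₀ Q).1 (hPm hQ'))
    intro g hg
    have hg0 : aeval x₀ g = 0 := (mem_vanishingIdeal_singleton_iff x₀ g).1 hg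
    have hmem : Q * g ∈ P := by
      rw [← IsPrime.vanishingIdeal_zeroLocus (K := K) P]
      intro z hz
      rw [map_mul]
      by_cases hzx : z = x₀
      · rw [hzx, hg0, mul_zero]
      · by_cases hhz : aeval z h = 0
        · rw [hQ, map_mul, hhz, zero_mul, zero_mul]
        · have hzT : z ∈ hfin.toFinset := by
            rw [Set.Finite.mem_toFinset]
            exact ⟨fun g hg => hz g (hSP (Ideal.subset_span hg)), hhz⟩
          rw [hQ, map_mul, map_prod, Finset.prod_eq_zero hzT (hq z hzx), mul_zero, zero_mul]
    exact (hP.mem_or_mem hmem).resolve_left hQP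
  have h1 := Ideal.height_le_card_of_mem_minimalPrimes_span_finset hmin
  exact_mod_cast (card_le_height_vanishingIdeal_singleton x₀).trans h1

end MvPolynomial

/-! ### Evaluation of Laurent polynomials -/

noncomputable section

variable {p : ℕ} [Fact p.Prime] {n : ℕ}

/-- The value of the monomial `x ^ a`. -/
def monomialValue (x : Fin n → ℂ_[p]) (a : Fin n → ℤ) : ℂ_[p] := ∏ i, x i ^ a i

lemma monomialValue_ne_zero {x : Fin n → ℂ_[p]} (hx : ∀ j, x j ≠ 0) (a : Fin n → ℤ) :
    monomialValue x a ≠ 0 :=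
  Finset.prod_ne_zero_iff.2 fun i _ => zpow_ne_zero _ (hx i)

lemma monomialValue_zero (x : Fin n → ℂ_[p]) : monomialValue x 0 = 1 := by
  simp [monomialValue]

lemma monomialValue_one (a : Fin n → ℤ) : monomialValue (1 : Fin n → ℂ_[p]) a = 1 := by
  simp [monomialValue]

lemma monomialValue_add {x : Fin n → ℂ_[p]} (hx : ∀ j, x j ≠ 0) (a b : Fin n → ℤ) :
    monomialValue x (a + b) = monomialValue x a * monomialValue x b := by
  simp only [monomialValue, ← Finset.prod_mul_distrib]
  exact Finset.prod_congr rfl fun i _ => zpow_add₀ (hx i) _ _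

lemma monomialValue_sub {x : Fin n → ℂ_[p]} (hx : ∀ j, x j ≠ 0) (a b : Fin n → ℤ) :
    monomialValue x (a - b) = monomialValue x a / monomialValue x b := by
  rw [eq_div_iff (monomialValue_ne_zero hx b), ← monomialValue_add hx, sub_add_cancel]

lemma monomialValue_mul (x y : Fin n → ℂ_[p]) (a : Fin n → ℤ) :
    monomialValue (x * y) a = monomialValue x a * monomialValue y a := by
  simp only [monomialValue, Pi.mul_apply, mul_zpow, Finset.prod_mul_distrib]

lemma monomialValue_single {x : Fin n → ℂ_[p]} (i : Fin n) (k : ℤ) :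
    monomialValue x (Pi.single i k) = x i ^ k := by
  rw [monomialValue, Finset.prod_eq_single i]
  · simp
  · intro j _ hj; simp [hj]
  · simp

namespace LaurentPoly

/-- Evaluation at a point as a linear functional. -/
def evalLin (x : Fin n → ℂ_[p]) : LaurentPoly p n →ₗ[ℂ_[p]] ℂ_[p] :=
  (Finsupp.linearCombination ℂ_[p] (monomialValue x)) ∘ₗ
    (AddMonoidAlgebra.coeffLinearEquiv ℂ_[p]).toLinearMap

lemma evalLin_apply (x : Fin n → ℂ_[p]) (f : LaurentPoly p n) : evalLin x f = f.evalAt x := rfl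

lemma evalAt_eq_sum (f : LaurentPoly p n) {A : Finset (Fin n → ℤ)}
    (h : f.supp ⊆ (A : Set (Fin n → ℤ))) (x : Fin n → ℂ_[p]) :
    f.evalAt x = ∑ a ∈ A, f.coeff a * monomialValue x a := by
  refine Finsupp.sum_of_support_subset _ (fun a ha => ?_) _ (by simp)
  exact h (Finsupp.mem_support_iff.1 ha)

lemma exists_mvPolynomial (f : LaurentPoly p n) : ∃ g : MvPolynomial (Fin n) ℂ_[p],
    ∀ x : Fin n → ℂ_[p], (∀ j, x j ≠ 0) → (MvPolynomial.aeval x g = 0 ↔ f.evalAt x = 0) := by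
  classical
  set N : Fin n → ℤ := fun i => ∑ a ∈ f.coeff.support, |a i| with hN
  refine ⟨∑ a ∈ f.coeff.support, MvPolynomial.monomial
    (Finsupp.equivFunOnFinite.symm fun i => (a i + N i).toNat) (f.coeff a), fun x hx => ?_⟩
  have key : MvPolynomial.aeval x (∑ a ∈ f.coeff.support, MvPolynomial.monomial
      (Finsupp.equivFunOnFinite.symm fun i => (a i + N i).toNat) (f.coeff a)) =
      f.evalAt x * monomialValue x N := by
    rw [map_sum, evalAt_eq_sum f (A := f.coeff.support)
      (fun a ha => Finset.mem_coe.2 (Finsupp.mem_support_iff.2 ha)), Finset.sum_mul]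
    refine Finset.sum_congr rfl fun a ha => ?_
    rw [MvPolynomial.aeval_monomial, mul_assoc, ← monomialValue_add hx, Finsupp.prod_fintype _ _
      (by simp)]
    simp only [Algebra.algebraMap_self, RingHom.id_apply, monomialValue]
    congr 1
    refine Finset.prod_congr rfl fun i _ => ?_
    have : 0 ≤ a i + N i := by
      have h1 : |a i| ≤ N i := Finset.single_le_sum (f := fun a : Fin n → ℤ => |a i|)
        (fun b _ => abs_nonneg _) ha
      have h2 := neg_abs_le (a i)
      linarith
    rw [← zpow_natCast]
    simp [Int.toNat_of_nonneg this]
  rw [key, mul_eq_zero, or_iff_left (monomialValue_ne_zero hx N)]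

end LaurentPoly

/-- A square system with a nonempty finite set of roots in the torus is linearly independent. -/
theorem linearIndependent_of_finite_torusZeros {F : Fin n → LaurentPoly p n}
    (hfin : (torusZeros F).Finite) (hne : (torusZeros F).Nonempty) :
    LinearIndependent ℂ_[p] F := by
  classical
  by_contra hF
  rw [linearIndependent_iff_notMem_span] at hF
  push Not at hF
  obtain ⟨i, hi⟩ := hF
  choose G hG using fun j => (F j).exists_mvPolynomial
  obtain ⟨x₀, hx₀, hx₀F⟩ := hne
  have hprod : ∀ x : Fin n → ℂ_[p], MvPolynomial.aeval x
      (∏ j : Fin n, (MvPolynomial.X j : MvPolynomial (Fin n) ℂ_[p])) ≠ 0 ↔ ∀ j, x j ≠ 0 := by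
    intro x
    rw [map_prod, Finset.prod_ne_zero_iff]
    simp
  have h := MvPolynomial.card_le_of_finite_zeros ((Finset.univ.erase i).image G)
    (∏ j, MvPolynomial.X j) (hfin.subset ?_) (x₀ := x₀) ?_ ((hprod x₀).2 hx₀)
  · have h1 := h.trans Finset.card_image_le
    rw [Finset.card_erase_of_mem (Finset.mem_univ i), Finset.card_univ, Fintype.card_fin] at h1
    have := i.pos
    omega
  · rintro x ⟨hx, hx0⟩
    rw [hprod] at hx0
    have hx' : ∀ j, j ≠ i → (F j).evalAt x = 0 := fun j hj =>
      (hG j x hx0).1 (hx _ (Finset.mem_image_of_mem _ (by simp [hj])))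
    refine ⟨hx0, fun j => ?_⟩
    by_cases hj : j = i
    · subst hj
      have : Submodule.span ℂ_[p] (F '' (Set.univ \ {j})) ≤
          LinearMap.ker (LaurentPoly.evalLin x) := by
        rw [Submodule.span_le]
        rintro _ ⟨k, hk, rfl⟩
        exact hx' k (by simpa using hk)
      exact this hi
    · exact hx' j hj
  · intro g hg
    obtain ⟨j, -, rfl⟩ := Finset.mem_image.1 hg
    exact (hG j x₀ hx₀).2 (hx₀F j)

end

/-! ### Level sets of weighted sums of logarithmic distances in an ultrametric field -/

section Ultrametric

variable {K ι : Type*} [NormedField K]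

/-- The indices of the centers `v b`, `b ∈ B`, in the open ball of radius `r` around `v a`. -/
noncomputable def branch (v : ι → K) (B : Finset ι) (r : ℝ) (a : ι) : Finset ι :=
  {b ∈ B | ‖v b - v a‖ < r}

lemma mem_branch {v : ι → K} {B : Finset ι} {r : ℝ} {a b : ι} :
    b ∈ branch v B r a ↔ b ∈ B ∧ ‖v b - v a‖ < r := by
  simp [branch]

lemma self_mem_branch {v : ι → K} {B : Finset ι} {r : ℝ} {a : ι} (ha : a ∈ B) (hr : 0 < r) :
    a ∈ branch v B r a := by
  simp [mem_branch, ha, hr]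

lemma exists_max_norm_sub (v : ι → K) {B : Finset ι} (hB : B.Nonempty) :
    ∃ a ∈ B, ∃ b ∈ B, ∀ a' ∈ B, ∀ b' ∈ B, ‖v a' - v b'‖ ≤ ‖v a - v b‖ := by
  obtain ⟨⟨a, b⟩, hab, h⟩ := (B ×ˢ B).exists_max_image (fun x => ‖v x.1 - v x.2‖) (hB.product hB)
  rw [Finset.mem_product] at hab
  exact ⟨a, hab.1, b, hab.2, fun a' ha' b' hb' => h (a', b') (Finset.mk_mem_product ha' hb')⟩

variable [IsUltrametricDist K]

lemma norm_sub_le_max_of_ultrametric (x y z : K) : ‖x - z‖ ≤ max ‖x - y‖ ‖y - z‖ := by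
  simpa using IsUltrametricDist.norm_add_le_max (x - y) (y - z)

lemma norm_sub_lt_of_ultrametric {x y z : K} {r : ℝ} (h₁ : ‖x - y‖ < r) (h₂ : ‖y - z‖ < r) :
    ‖x - z‖ < r :=
  (norm_sub_le_max_of_ultrametric x y z).trans_lt (max_lt h₁ h₂)

lemma branch_eq_branch_iff {v : ι → K} {B : Finset ι} {r : ℝ} (hr : 0 < r) {a b : ι} (hb : b ∈ B) :
    branch v B r b = branch v B r a ↔ ‖v b - v a‖ < r := by
  constructor
  · intro h
    have := self_mem_branch (v := v) hb hr
    rw [h] at this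
    exact (mem_branch.1 this).2
  · intro h
    ext c
    simp only [mem_branch, and_congr_right_iff]
    intro _
    exact ⟨fun h' => norm_sub_lt_of_ultrametric h' h,
      fun h' => norm_sub_lt_of_ultrametric h' (by rwa [norm_sub_rev])⟩

lemma sum_branches [DecidableEq ι] {M : Type*} [AddCommMonoid M] {v : ι → K} {B : Finset ι}
    {r : ℝ} (hr : 0 < r) (f : ι → M) : ∑ D ∈ B.image (branch v B r), ∑ a ∈ D, f a = ∑ a ∈ B, f a := by
  refine Finset.sum_image' f fun a ha => Finset.sum_congr ?_ fun _ _ => rfl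
  ext b
  simp only [mem_branch, Finset.mem_filter]
  exact and_congr_right fun hb => (branch_eq_branch_iff hr hb).symm

lemma card_le_sum_branches [DecidableEq ι] {v : ι → K} {B : Finset ι} {r : ℝ} [DecidableEq K]
    (S : Finset K) (h : ∀ z ∈ S, ∃ a ∈ B, ‖z - v a‖ < r) :
    S.card ≤ ∑ D ∈ B.image (branch v B r), {z ∈ S | ∀ a ∈ D, ‖z - v a‖ < r}.card := by
  refine le_trans (Finset.card_le_card fun z hz => ?_) Finset.card_biUnion_le
  obtain ⟨a, ha, haz⟩ := h z hz
  refine Finset.mem_biUnion.2 ⟨_, Finset.mem_image_of_mem _ ha, Finset.mem_filter.2 ⟨hz, ?_⟩⟩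
  intro b hb
  exact norm_sub_lt_of_ultrametric haz (by rw [norm_sub_rev]; exact (mem_branch.1 hb).2)

/-- Inside one branch, the distances to the centers of the other branches are constant. -/
lemma norm_eq_of_not_mem_branch {v : ι → K} {B : Finset ι} {r : ℝ} {a b : ι} {z : K}
    (hle : ∀ a ∈ B, ∀ b ∈ B, ‖v a - v b‖ ≤ r) (ha : a ∈ B) (hb : b ∈ B)
    (hz : ‖z - v a‖ < r) (hab : b ∉ branch v B r a) : ‖z - v b‖ = r := by
  have h1 : ‖v a - v b‖ = r := by
    refine le_antisymm (hle a ha b hb) (not_lt.1 fun h => hab (mem_branch.2 ⟨hb, ?_⟩))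
    rwa [norm_sub_rev]
  refine le_antisymm ((norm_sub_le_max_of_ultrametric z (v a) (v b)).trans
    (max_le hz.le h1.le)) ?_
  by_contra! h
  have := norm_sub_lt_of_ultrametric (x := v a) (y := z) (by rwa [norm_sub_rev]) h
  exact this.ne h1

/-- A point far from all centers has the same distance to all of them. -/
lemma norm_eq_of_forall_le {v : ι → K} {B : Finset ι} {r : ℝ} {a b : ι} {z : K}
    (hle : ∀ a ∈ B, ∀ b ∈ B, ‖v a - v b‖ ≤ r) (hz : ∀ a ∈ B, r ≤ ‖z - v a‖)
    (ha : a ∈ B) (hb : b ∈ B) : ‖z - v a‖ = ‖z - v b‖ :=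
  le_antisymm
    ((norm_sub_le_max_of_ultrametric z (v b) (v a)).trans
      (max_le le_rfl ((hle b hb a ha).trans (hz b hb))))
    ((norm_sub_le_max_of_ultrametric z (v a) (v b)).trans
      (max_le le_rfl ((hle a ha b hb).trans (hz a ha))))

/-- The weighted sum of the logarithmic distances, restricted to a branch. -/
lemma sum_branch_log {v : ι → K} {m : ι → ℝ} {B : Finset ι} {r : ℝ} {a : ι} {z : K} (s : ℝ)
    (hle : ∀ a ∈ B, ∀ b ∈ B, ‖v a - v b‖ ≤ r) (ha : a ∈ B) (hz : ‖z - v a‖ < r) :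
    ∑ b ∈ branch v B r a, m b * (Real.log ‖z - v b‖ - Real.log r) =
      ∑ b ∈ B, m b * (Real.log ‖z - v b‖ - s) - (∑ b ∈ B, m b) * (Real.log r - s) := by
  have : ∑ b ∈ branch v B r a, m b * (Real.log ‖z - v b‖ - Real.log r) =
      ∑ b ∈ B, m b * (Real.log ‖z - v b‖ - Real.log r) := by
    refine Finset.sum_subset (Finset.filter_subset _ _) fun b hb hb' => ?_
    rw [norm_eq_of_not_mem_branch hle ha hb hz hb', sub_self, mul_zero]
  rw [this, Finset.sum_mul, ← Finset.sum_sub_distrib]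
  exact Finset.sum_congr rfl fun b _ => by ring

/-- A level set of a weighted sum of logarithmic distances to the centers `v a`, `a ∈ B`, inside a
ball containing the centers meets at most `#B` classes of points with the same distances to all
centers, provided that no partial sum of the weights vanishes. -/
theorem card_level_le (v : ι → K) (m : ι → ℝ) (B : Finset ι) (hB : B.Nonempty)
    (hm : ∀ C ⊆ B, C.Nonempty → ∑ a ∈ C, m a ≠ 0) {r : ℝ} (hr : 0 < r)
    (hvr : ∀ a ∈ B, ∀ b ∈ B, ‖v a - v b‖ < r) (c : ℝ) (S : Finset K)
    (hne : ∀ z ∈ S, ∀ a ∈ B, z ≠ v a) (hSr : ∀ z ∈ S, ∀ a ∈ B, ‖z - v a‖ < r)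
    (hc : ∀ z ∈ S, ∑ a ∈ B, m a * (Real.log ‖z - v a‖ - Real.log r) = c)
    (hinj : ∀ z ∈ S, ∀ w ∈ S, (∀ a ∈ B, ‖z - v a‖ = ‖w - v a‖) → z = w) :
    S.card ≤ B.card ∧ (0 ≤ c * ∑ a ∈ B, m a → S.card + 1 ≤ B.card) := by
  classical
  induction hN : B.card using Nat.strong_induction_on generalizing B r c S with
  | _ N ih =>
  subst hN
  obtain ⟨a₀, ha₀, b₀, hb₀, hmax⟩ := exists_max_norm_sub v hB
  set r' := ‖v a₀ - v b₀‖ with hr'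
  set M := ∑ a ∈ B, m a with hM
  have hM0 : M ≠ 0 := hm B le_rfl hB
  have hM2 : 0 < M * M := mul_self_pos.2 hM0
  set T := {z ∈ S | ∀ a ∈ B, r' ≤ ‖z - v a‖} with hT
  have hTS : ∀ z ∈ T, z ∈ S := fun z hz => (Finset.mem_filter.1 hz).1
  have hTc : ∀ z ∈ T, ∀ a ∈ B, ‖z - v a‖ = ‖z - v a₀‖ := fun z hz a ha =>
    norm_eq_of_forall_le hmax (Finset.mem_filter.1 hz).2 ha ha₀
  have hTM : ∀ z ∈ T, M * (Real.log ‖z - v a₀‖ - Real.log r) = c := by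
    intro z hz
    rw [← hc z (hTS z hz), hM, Finset.sum_mul]
    exact Finset.sum_congr rfl fun a ha => by rw [hTc z hz a ha]
  have hpos : ∀ z ∈ S, ∀ a ∈ B, 0 < ‖z - v a‖ := fun z hz a ha =>
    norm_pos_iff.2 (sub_ne_zero.2 (hne z hz a ha))
  have hT1 : T.card ≤ 1 := by
    refine Finset.card_le_one.2 fun z hz w hw => hinj z (hTS z hz) w (hTS w hw) fun a ha => ?_
    rw [hTc z hz a ha, hTc w hw a ha]
    have h := (hTM z hz).trans (hTM w hw).symm
    have h' := mul_left_cancel₀ hM0 h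
    exact Real.log_injOn_pos (hpos z (hTS z hz) a₀ ha₀) (hpos w (hTS w hw) a₀ ha₀) (by linarith)
  have hTneg : ∀ z ∈ T, c * M < 0 := by
    intro z hz
    rw [← hTM z hz]
    have := Real.log_lt_log (hpos z (hTS z hz) a₀ ha₀) (hSr z (hTS z hz) a₀ ha₀)
    nlinarith
  by_cases hr0 : r' = 0
  · have hST : S = T := by
      rw [hT, Finset.filter_true_of_mem]
      intro z _ a _
      rw [hr0]; exact norm_nonneg _
    refine ⟨hST ▸ hT1.trans hB.card_pos, fun h => ?_⟩
    rcases T.eq_empty_or_nonempty with h0 | ⟨z, hz⟩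
    · rw [hST, h0]; exact hB.card_pos
    · exact absurd (hTneg z hz) (not_lt.2 h)
  have hr'0 : 0 < r' := lt_of_le_of_ne (norm_nonneg _) (Ne.symm hr0)
  have hr'r : r' < r := hvr a₀ ha₀ b₀ hb₀
  have hlog : Real.log r' < Real.log r := Real.log_lt_log hr'0 hr'r
  set c' := c - M * (Real.log r' - Real.log r) with hc'
  set P := B.image (branch v B r') with hP
  have hPne : P.Nonempty := hB.image _
  set SD : Finset ι → Finset K := fun D => {z ∈ S | ∀ a ∈ D, ‖z - v a‖ < r'} with hSD
  have hbound : ∀ D ∈ P, (SD D).card ≤ D.card ∧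
      (0 ≤ c' * ∑ a ∈ D, m a → (SD D).card + 1 ≤ D.card) := by
    intro D hD
    obtain ⟨a, ha, rfl⟩ := Finset.mem_image.1 hD
    have hsub : branch v B r' a ⊆ B := Finset.filter_subset _ _
    have haD := self_mem_branch (v := v) ha hr'0
    refine ih _ (Finset.card_lt_card ⟨hsub, fun h => ?_⟩) _ ⟨a, haD⟩
      (fun C hC => hm C (hC.trans hsub)) hr'0 ?_ c' _ ?_ ?_ ?_ ?_ rfl
    · have h1 := (mem_branch.1 (h ha₀)).2
      have h2 := (mem_branch.1 (h hb₀)).2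
      rw [norm_sub_rev] at h2
      exact (norm_sub_lt_of_ultrametric h1 h2).ne rfl
    · intro b hb d hd
      refine norm_sub_lt_of_ultrametric (mem_branch.1 hb).2 ?_
      rw [norm_sub_rev]
      exact (mem_branch.1 hd).2
    · intro z hz b hb
      exact hne z (Finset.mem_filter.1 hz).1 b (hsub hb)
    · intro z hz b hb
      exact (Finset.mem_filter.1 hz).2 b hb
    · intro z hz
      rw [sum_branch_log (Real.log r) hmax ha ((Finset.mem_filter.1 hz).2 a haD),
        hc z (Finset.mem_filter.1 hz).1]
    · intro z hz w hw h
      refine hinj z (Finset.mem_filter.1 hz).1 w (Finset.mem_filter.1 hw).1 fun b hb => ?_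
      by_cases hbD : b ∈ branch v B r' a
      · exact h b hbD
      · rw [norm_eq_of_not_mem_branch hmax ha hb ((Finset.mem_filter.1 hz).2 a haD) hbD,
          norm_eq_of_not_mem_branch hmax ha hb ((Finset.mem_filter.1 hw).2 a haD) hbD]
  have hcard : ∑ D ∈ P, D.card = B.card := by
    simp only [Finset.card_eq_sum_ones]
    exact sum_branches hr'0 _
  have hMsum : ∑ D ∈ P, c' * ∑ a ∈ D, m a = c' * M := by
    rw [← Finset.mul_sum, hP, sum_branches hr'0]
  have htot : (∑ D ∈ P, (SD D).card) ≤ B.card := by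
    rw [← hcard]
    exact Finset.sum_le_sum fun D hD => (hbound D hD).1
  have htot' : 0 ≤ c' * M → (∑ D ∈ P, (SD D).card) + 1 ≤ B.card := by
    intro h
    rw [← hMsum] at h
    obtain ⟨D, hD, hD0⟩ : ∃ D ∈ P, 0 ≤ c' * ∑ a ∈ D, m a := by
      by_contra! hcon
      exact absurd (Finset.sum_lt_sum_of_nonempty hPne hcon) (by simpa using h)
    rw [← hcard, Nat.succ_le_iff]
    exact Finset.sum_lt_sum (fun D hD => (hbound D hD).1) ⟨D, hD, (hbound D hD).2 hD0⟩
  have hsplit : S.card ≤ T.card + ∑ D ∈ P, (SD D).card := by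
    rw [← Finset.card_filter_add_card_filter_not (s := S) (fun z => ∀ a ∈ B, r' ≤ ‖z - v a‖)]
    refine Nat.add_le_add le_rfl ?_
    refine (card_le_sum_branches (v := v) (B := B) (r := r') _ fun z hz => ?_).trans ?_
    · have := (Finset.mem_filter.1 hz).2
      push Not at this
      exact this
    · refine Finset.sum_le_sum fun D _ => Finset.card_le_card ?_
      exact Finset.filter_subset_filter _ (Finset.filter_subset _ _)
  constructor
  · rcases T.eq_empty_or_nonempty with h0 | ⟨z, hz⟩
    · rw [h0, Finset.card_empty, zero_add] at hsplit
      exact hsplit.trans htot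
    · have h1 : 0 ≤ c' * M := by
        have h2 := Real.log_le_log hr'0 ((Finset.mem_filter.1 hz).2 a₀ ha₀)
        have : c' = M * (Real.log ‖z - v a₀‖ - Real.log r') := by
          rw [hc', ← hTM z hz]; ring
        rw [this]
        nlinarith
      have := htot' h1
      omega
  · intro h
    have h0 : T = ∅ := by
      rw [Finset.eq_empty_iff_forall_notMem]
      exact fun z hz => absurd (hTneg z hz) (not_lt.2 h)
    rw [h0, Finset.card_empty, zero_add] at hsplit
    have h1 : 0 ≤ c' * M := by
      rw [hc']
      nlinarith
    have := htot' h1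
    omega

/-- The zero set of a weighted sum of logarithmic distances with weights of sum zero and no other
vanishing partial sums meets at most `#B - 2` classes of points with the same nonconstant
distances to the centers. -/
theorem card_zero_level_le (v : ι → K) (m : ι → ℝ) (B : Finset ι) (hB : 2 ≤ B.card)
    (hm0 : ∑ a ∈ B, m a = 0)
    (hm : ∀ C ⊂ B, C.Nonempty → ∑ a ∈ C, m a ≠ 0) (S : Finset K)
    (hne : ∀ z ∈ S, ∀ a ∈ B, z ≠ v a)
    (hc : ∀ z ∈ S, ∑ a ∈ B, m a * Real.log ‖z - v a‖ = 0)
    (hnc : ∀ z ∈ S, ∃ a ∈ B, ∃ b ∈ B, ‖z - v a‖ ≠ ‖z - v b‖)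
    (hinj : ∀ z ∈ S, ∀ w ∈ S, (∀ a ∈ B, ‖z - v a‖ = ‖w - v a‖) → z = w) :
    S.card + 2 ≤ B.card := by
  classical
  rcases S.eq_empty_or_nonempty with h0 | ⟨z₀, hz₀⟩
  · simpa [h0] using hB
  have hBne : B.Nonempty := Finset.card_pos.1 (by omega)
  obtain ⟨a₀, ha₀, b₀, hb₀, hmax⟩ := exists_max_norm_sub v hBne
  set r := ‖v a₀ - v b₀‖ with hr
  have hlt : ∀ z ∈ S, ∃ a ∈ B, ‖z - v a‖ < r := by
    intro z hz
    by_contra! hcon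
    obtain ⟨a, ha, b, hb, hab⟩ := hnc z hz
    exact hab (norm_eq_of_forall_le hmax hcon ha hb)
  have hr0 : 0 < r := by
    obtain ⟨a, _, ha⟩ := hlt z₀ hz₀
    exact (norm_nonneg _).trans_lt ha
  have hPtwo : 2 ≤ (B.image (branch v B r)).card := by
    have : branch v B r a₀ ≠ branch v B r b₀ := by
      rw [Ne, branch_eq_branch_iff hr0 ha₀]
      exact lt_irrefl _
    exact Finset.one_lt_card.2 ⟨_, Finset.mem_image_of_mem _ ha₀, _,
      Finset.mem_image_of_mem _ hb₀, this⟩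
  have hcard : ∑ D ∈ B.image (branch v B r), D.card = B.card := by
    simp only [Finset.card_eq_sum_ones]
    exact sum_branches hr0 _
  have hS := card_le_sum_branches S hlt
  have hbound : ∀ D ∈ B.image (branch v B r),
      {z ∈ S | ∀ a ∈ D, ‖z - v a‖ < r}.card + 1 ≤ D.card := by
    intro D hD
    obtain ⟨a, ha, rfl⟩ := Finset.mem_image.1 hD
    have haD := self_mem_branch (v := v) ha hr0
    have hss : branch v B r a ⊂ B := by
      refine ⟨Finset.filter_subset _ _, fun h => ?_⟩
      have h1 := (mem_branch.1 (h ha₀)).2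
      have h2 := (mem_branch.1 (h hb₀)).2
      rw [norm_sub_rev] at h2
      exact (norm_sub_lt_of_ultrametric h1 h2).ne rfl
    refine (card_level_le v m _ ⟨a, haD⟩ (fun C hC => hm C (hC.trans_ssubset hss)) hr0 ?_ 0 _
      ?_ ?_ ?_ ?_).2 (by simp)
    · intro b hb d hd
      refine norm_sub_lt_of_ultrametric (mem_branch.1 hb).2 ?_
      rw [norm_sub_rev]
      exact (mem_branch.1 hd).2
    · intro z hz b hb
      exact hne z (Finset.mem_filter.1 hz).1 b (hss.1 hb)
    · intro z hz b hb
      exact (Finset.mem_filter.1 hz).2 b hb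
    · intro z hz
      rw [sum_branch_log 0 hmax ha ((Finset.mem_filter.1 hz).2 a haD), hm0]
      simpa using hc z (Finset.mem_filter.1 hz).1
    · intro z hz w hw h
      refine hinj z (Finset.mem_filter.1 hz).1 w (Finset.mem_filter.1 hw).1 fun b hb => ?_
      by_cases hbD : b ∈ branch v B r a
      · exact h b hbD
      · rw [norm_eq_of_not_mem_branch hmax ha hb ((Finset.mem_filter.1 hz).2 a haD) hbD,
          norm_eq_of_not_mem_branch hmax ha hb ((Finset.mem_filter.1 hw).2 a haD) hbD]
  have := Finset.sum_le_sum hbound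
  rw [Finset.sum_add_distrib, hcard, Finset.sum_const, smul_eq_mul, mul_one] at this
  omega

end Ultrametric

noncomputable section

/-! ### Valuations of monomials -/

section Valuation

variable {p : ℕ} [hp : Fact p.Prime] {n : ℕ}

lemma ordC_one : ordC p 1 = 0 := by simp [ordC]

lemma ordC_mul {x y : ℂ_[p]} (hx : x ≠ 0) (hy : y ≠ 0) : ordC p (x * y) = ordC p x + ordC p y := by
  rw [ordC, norm_mul, Real.logb_mul (norm_ne_zero_iff.2 hx) (norm_ne_zero_iff.2 hy)]
  simp [ordC]; ring

lemma ordC_inv (x : ℂ_[p]) : ordC p x⁻¹ = -ordC p x := by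
  simp [ordC, Real.logb_inv]

lemma ordC_div {x y : ℂ_[p]} (hx : x ≠ 0) (hy : y ≠ 0) : ordC p (x / y) = ordC p x - ordC p y := by
  rw [div_eq_mul_inv, ordC_mul hx (inv_ne_zero hy), ordC_inv, sub_eq_add_neg]

lemma ordC_pow (x : ℂ_[p]) (k : ℕ) : ordC p (x ^ k) = k * ordC p x := by
  simp [ordC, Real.logb_pow]

lemma ordC_zpow (x : ℂ_[p]) (k : ℤ) : ordC p (x ^ k) = k * ordC p x := by
  simp [ordC, Real.logb, Real.log_zpow]; ring

lemma ordC_prod {ι : Type*} (s : Finset ι) {f : ι → ℂ_[p]} (hf : ∀ i ∈ s, f i ≠ 0) :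
    ordC p (∏ i ∈ s, f i) = ∑ i ∈ s, ordC p (f i) := by
  classical
  induction s using Finset.induction_on with
  | empty => simp [ordC_one]
  | insert i s hi ih =>
    rw [Finset.prod_insert hi, Finset.sum_insert hi, ordC_mul (hf i (Finset.mem_insert_self i s)),
      ih fun j hj => hf j (Finset.mem_insert_of_mem hj)]
    exact Finset.prod_ne_zero_iff.2 fun j hj => hf j (Finset.mem_insert_of_mem hj)

lemma ordC_monomialValue {x : Fin n → ℂ_[p]} (hx : ∀ j, x j ≠ 0) (a : Fin n → ℤ) :
    ordC p (monomialValue x a) = ∑ i, (a i : ℝ) * ordC p (x i) := by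
  rw [monomialValue, ordC_prod _ fun i _ => zpow_ne_zero _ (hx i)]
  exact Finset.sum_congr rfl fun i _ => ordC_zpow _ _

lemma one_lt_natCast_prime : (1 : ℝ) < p := by exact_mod_cast hp.1.one_lt

lemma norm_natCast_prime : ‖(p : ℂ_[p])‖ = (p : ℝ)⁻¹ := by
  have h := PadicComplex.norm_extends' p (p : ℚ_[p])
  rw [Padic.norm_p] at h
  rw [← h]
  congr 1
  simp

lemma ordC_natCast_prime : ordC p (p : ℂ_[p]) = 1 := by
  rw [ordC, norm_natCast_prime, Real.logb_inv, neg_neg, Real.logb_self_eq_one one_lt_natCast_prime]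

lemma natCast_prime_ne_zero : (p : ℂ_[p]) ≠ 0 := by exact_mod_cast hp.1.ne_zero

lemma ordC_eq_iff {x y : ℂ_[p]} (hx : x ≠ 0) (hy : y ≠ 0) : ordC p x = ordC p y ↔ ‖x‖ = ‖y‖ := by
  rw [ordC, ordC, neg_inj]
  exact ⟨fun h => Real.logb_injOn_pos one_lt_natCast_prime (norm_pos_iff.2 hx)
    (norm_pos_iff.2 hy) h,
    fun h => by rw [h]⟩

lemma ordC_lt_iff {x y : ℂ_[p]} (hx : x ≠ 0) (hy : y ≠ 0) : ordC p x < ordC p y ↔ ‖y‖ < ‖x‖ := by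
  rw [ordC, ordC, neg_lt_neg_iff,
    Real.logb_lt_logb_iff one_lt_natCast_prime (norm_pos_iff.2 hy) (norm_pos_iff.2 hx)]

end Valuation

/-! ### Exponents of systems with finitely many roots -/

section Exponents

variable {p : ℕ} [hp : Fact p.Prime] {n : ℕ} {A : Finset (Fin n → ℤ)}
  {F : Fin n → LaurentPoly p n}

lemma monomialValue_zpow (c : ℂ_[p]) (hc : c ≠ 0) (w a : Fin n → ℤ) :
    monomialValue (fun i => c ^ w i) a = c ^ ∑ i, a i * w i := by
  rw [monomialValue]
  have : ∀ s : Finset (Fin n), ∏ i ∈ s, (c ^ w i) ^ a i = c ^ ∑ i ∈ s, a i * w i := by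
    intro s
    induction s using Finset.induction_on with
    | empty => simp
    | insert i s hi ih =>
      rw [Finset.prod_insert hi, Finset.sum_insert hi, ih, zpow_add₀ hc, ← zpow_mul, mul_comm (w i)]
  exact this _

/-- If the differences of the exponents do not span, the torus contains a one-parameter subgroup
preserving the roots. -/
lemma eq_zero_of_orthogonal_int (hF : ∀ i, (F i).supp ⊆ (A : Set (Fin n → ℤ)))
    (hfin : (torusZeros F).Finite) (hne : (torusZeros F).Nonempty) (w : Fin n → ℤ) (c : ℤ)
    (hw : ∀ a ∈ A, ∑ i, a i * w i = c) : w = 0 := by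
  by_contra hw0
  obtain ⟨j, hj⟩ := Function.ne_iff.1 hw0
  obtain ⟨x, hx, hxF⟩ := hne
  set g : ℕ → Fin n → ℂ_[p] := fun k => x * fun i => ((p : ℂ_[p]) ^ k) ^ w i with hg
  have hpk : ∀ k : ℕ, (p : ℂ_[p]) ^ k ≠ 0 := fun k => pow_ne_zero k natCast_prime_ne_zero
  refine Set.infinite_of_injective_forall_mem (f := g) ?_ ?_ hfin
  · intro k l hkl
    have h1 : ordC p (g k j) = ordC p (g l j) := by rw [hkl]
    simp only [hg, Pi.mul_apply] at h1
    rw [ordC_mul (hx j) (zpow_ne_zero _ (hpk k)), ordC_mul (hx j) (zpow_ne_zero _ (hpk l)),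
      ordC_zpow, ordC_zpow, ordC_pow, ordC_pow, ordC_natCast_prime] at h1
    have hj' : (w j : ℝ) ≠ 0 := by exact_mod_cast hj
    have h2 := mul_left_cancel₀ hj' (add_left_cancel h1)
    simpa using h2
  · intro k
    refine ⟨fun i => mul_ne_zero (hx i) (zpow_ne_zero _ (hpk k)), fun i => ?_⟩
    have h0 := hxF i
    rw [LaurentPoly.evalAt_eq_sum _ (hF i)] at h0 ⊢
    have : ∀ a ∈ A, (F i).coeff a * monomialValue (g k) a =
        ((p : ℂ_[p]) ^ k) ^ c * ((F i).coeff a * monomialValue x a) := by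
      intro a ha
      rw [hg, monomialValue_mul, monomialValue_zpow _ (hpk k), hw a ha]
      ring
    rw [Finset.sum_congr rfl this, ← Finset.mul_sum, h0, mul_zero]

lemma eq_zero_of_orthogonal (hF : ∀ i, (F i).supp ⊆ (A : Set (Fin n → ℤ)))
    (hfin : (torusZeros F).Finite) (hne : (torusZeros F).Nonempty) (w : Fin n → ℝ) (c : ℝ)
    (hw : ∀ a ∈ A, ∑ i, (a i : ℝ) * w i = c) : w = 0 := by
  by_contra hw0
  obtain ⟨j, hj⟩ := Function.ne_iff.1 hw0
  have : ∃ φ : Module.Dual ℚ ℝ, φ (w j) ≠ 0 := by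
    by_contra! hcon
    exact hj ((Module.forall_dual_apply_eq_zero_iff ℚ (w j)).1 hcon)
  obtain ⟨φ, hφ⟩ := this
  set N : ℕ := (∏ i, (φ (w i)).den) * (φ c).den with hN
  have hint : ∀ q : ℚ, q.den ∣ N → ∃ z : ℤ, (z : ℚ) = N * q := by
    rintro q ⟨d, hd⟩
    refine ⟨d * q.num, ?_⟩
    rw [hd]
    push_cast
    rw [mul_comm (q.den : ℚ), mul_assoc, Rat.den_mul_eq_num]
  have h1 : ∀ i, ∃ z : ℤ, (z : ℚ) = N * φ (w i) := fun i => hint _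
    ((Finset.dvd_prod_of_mem (fun i => (φ (w i)).den) (Finset.mem_univ i)).mul_right _)
  obtain ⟨c', hc'⟩ := hint (φ c) (dvd_mul_left _ _)
  choose w' hw' using h1
  have hN0 : (N : ℚ) ≠ 0 := by
    rw [hN]
    exact_mod_cast mul_ne_zero (Finset.prod_ne_zero_iff.2 fun i _ => (φ (w i)).den_ne_zero)
      (φ c).den_ne_zero
  have h2 := eq_zero_of_orthogonal_int hF hfin hne w' c' fun a ha => by
    have h3 := congrArg φ (hw a ha)
    have h4 : φ (∑ i, (a i : ℝ) * w i) = ∑ i, (a i : ℚ) * φ (w i) := by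
      rw [map_sum]
      refine Finset.sum_congr rfl fun i _ => ?_
      have : (a i : ℝ) * w i = a i • w i := by simp
      rw [this, map_zsmul]
      simp
    rw [h4] at h3
    have h5 : ((∑ i, a i * w' i : ℤ) : ℚ) = c' := by
      push_cast
      rw [hc', ← h3, Finset.mul_sum]
      exact Finset.sum_congr rfl fun i _ => by rw [hw' i]; ring
    exact_mod_cast h5
  have h6 := hw' j
  rw [h2] at h6
  simp only [Pi.zero_apply, Int.cast_zero] at h6
  exact (mul_ne_zero hN0 hφ) h6.symm

/-- Two roots have the same valuations as soon as the valuations of the monomials occurring in the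
system agree up to a constant. -/
lemma ordVec_eq_of_monomials (hF : ∀ i, (F i).supp ⊆ (A : Set (Fin n → ℤ)))
    (hfin : (torusZeros F).Finite) (hne : (torusZeros F).Nonempty) {x y : Fin n → ℂ_[p]}
    (hx : ∀ j, x j ≠ 0) (hy : ∀ j, y j ≠ 0) (c : ℝ)
    (h : ∀ a ∈ A, ordC p (monomialValue x a) = ordC p (monomialValue y a) + c) :
    ordVec x = ordVec y := by
  have := eq_zero_of_orthogonal hF hfin hne (ordVec x - ordVec y) c fun a ha => by
    have h1 := h a ha
    rw [ordC_monomialValue hx, ordC_monomialValue hy] at h1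
    simp only [Pi.sub_apply, mul_sub, Finset.sum_sub_distrib, ordVec]
    linarith
  exact sub_eq_zero.1 this

/-! ### The linear system satisfied by the monomials -/

/-- The coefficient matrix of a system, scaled by the values of the monomials at a point. -/
def scaledMatrix (A : Finset (Fin n → ℤ)) (F : Fin n → LaurentPoly p n) (x : Fin n → ℂ_[p]) :
    Matrix (Fin n) A ℂ_[p] :=
  Matrix.of fun i a => (F i).coeff a * monomialValue x a

lemma linearIndependent_scaledMatrix (hF : ∀ i, (F i).supp ⊆ (A : Set (Fin n → ℤ)))
    (hli : LinearIndependent ℂ_[p] F) {x : Fin n → ℂ_[p]} (hx : ∀ j, x j ≠ 0) :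
    LinearIndependent ℂ_[p] (scaledMatrix A F x).row := by
  rw [Fintype.linearIndependent_iff] at hli ⊢
  intro g hg
  refine hli g ?_
  apply AddMonoidAlgebra.coeff_injective
  ext a
  rw [AddMonoidAlgebra.coeff_sum, Finsupp.finsetSum_apply]
  simp only [AddMonoidAlgebra.coeff_smul, Finsupp.smul_apply, smul_eq_mul,
    AddMonoidAlgebra.coeff_zero, Finsupp.zero_apply]
  by_cases ha : a ∈ A
  · have h := congrFun hg ⟨a, ha⟩
    simp only [Finset.sum_apply, Pi.smul_apply, Matrix.row, scaledMatrix, Matrix.of_apply,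
      smul_eq_mul, Pi.zero_apply, ← mul_assoc, ← Finset.sum_mul] at h
    exact (mul_eq_zero.1 h).resolve_right (monomialValue_ne_zero hx a)
  · refine Finset.sum_eq_zero fun i _ => ?_
    have : (F i).coeff a = 0 := by
      by_contra h
      exact ha (hF i h)
    rw [this, mul_zero]

lemma finrank_ker_scaledMatrix (hF : ∀ i, (F i).supp ⊆ (A : Set (Fin n → ℤ)))
    (hli : LinearIndependent ℂ_[p] F) {x : Fin n → ℂ_[p]} (hx : ∀ j, x j ≠ 0) :
    Module.finrank ℂ_[p] (LinearMap.ker (scaledMatrix A F x).mulVecLin) + n = A.card := by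
  have h1 := (linearIndependent_scaledMatrix hF hli hx).rank_matrix
  have h2 := LinearMap.finrank_range_add_finrank_ker (scaledMatrix A F x).mulVecLin
  rw [← Matrix.rank, h1, Fintype.card_fin, Module.finrank_fintype_fun_eq_card,
    Fintype.card_coe] at h2
  omega

lemma mem_ker_scaledMatrix_iff (hF : ∀ i, (F i).supp ⊆ (A : Set (Fin n → ℤ)))
    {x y : Fin n → ℂ_[p]} (hx : ∀ j, x j ≠ 0) (hy : ∀ j, y j ≠ 0) :
    (fun a : A => monomialValue y a / monomialValue x a) ∈
      LinearMap.ker (scaledMatrix A F x).mulVecLin ↔ y ∈ torusZeros F := by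
  have : ∀ i, (scaledMatrix A F x).mulVec (fun a : A => monomialValue y a / monomialValue x a) i =
      (F i).evalAt y := by
    intro i
    rw [LaurentPoly.evalAt_eq_sum _ (hF i), ← Finset.sum_coe_sort]
    refine Finset.sum_congr rfl fun a _ => ?_
    have := monomialValue_ne_zero hx (a : Fin n → ℤ)
    simp only [scaledMatrix, Matrix.of_apply]
    field_simp
  rw [LinearMap.mem_ker, Matrix.mulVecLin_apply]
  refine ⟨fun h => ⟨hy, fun i => ?_⟩, fun h => funext fun i => ?_⟩
  · rw [← this i, h, Pi.zero_apply]
  · rw [this i, h.2 i, Pi.zero_apply]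

lemma one_mem_ker_scaledMatrix (hF : ∀ i, (F i).supp ⊆ (A : Set (Fin n → ℤ)))
    {x : Fin n → ℂ_[p]} (hx : x ∈ torusZeros F) :
    (1 : A → ℂ_[p]) ∈ LinearMap.ker (scaledMatrix A F x).mulVecLin := by
  have := (mem_ker_scaledMatrix_iff hF hx.1 hx.1).2 hx
  convert this using 1
  ext a
  rw [Pi.one_apply, div_self (monomialValue_ne_zero hx.1 _)]

/-- A square system with a nonempty finite set of roots involves more monomials than variables. -/
lemma lt_card_of_finite_torusZeros (hn : 1 ≤ n) (hF : ∀ i, (F i).supp ⊆ (A : Set (Fin n → ℤ)))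
    (hfin : (torusZeros F).Finite) (hne : (torusZeros F).Nonempty) : n < A.card := by
  have hli := linearIndependent_of_finite_torusZeros hfin hne
  obtain ⟨x, hx⟩ := hne
  have h := finrank_ker_scaledMatrix hF hli hx.1
  have hA : Nonempty A := by
    rw [← Fintype.card_pos_iff, Fintype.card_coe]; omega
  have : LinearMap.ker (scaledMatrix A F x).mulVecLin ≠ ⊥ :=
    (Submodule.ne_bot_iff _).2 ⟨1, one_mem_ker_scaledMatrix hF hx, one_ne_zero⟩
  have := Submodule.one_le_finrank_iff.2 this
  omega

/-- If there is one monomial more than there are variables, then the monomials take proportional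
values at all roots. -/
lemma exists_smul_of_card_eq_add_one (hcard : A.card = n + 1)
    (hF : ∀ i, (F i).supp ⊆ (A : Set (Fin n → ℤ)))
    (hfin : (torusZeros F).Finite) {x y : Fin n → ℂ_[p]} (hx : x ∈ torusZeros F)
    (hy : y ∈ torusZeros F) : ∃ c, ∀ a ∈ A, monomialValue y a = c * monomialValue x a := by
  have hli := linearIndependent_of_finite_torusZeros hfin ⟨x, hx⟩
  have h := finrank_ker_scaledMatrix hF hli hx.1
  have hA : Nonempty A := by
    rw [← Fintype.card_pos_iff, Fintype.card_coe]; omega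
  have h1 : Module.finrank ℂ_[p] (LinearMap.ker (scaledMatrix A F x).mulVecLin) = 1 := by omega
  have h0 : (⟨1, one_mem_ker_scaledMatrix hF hx⟩ :
      LinearMap.ker (scaledMatrix A F x).mulVecLin) ≠ 0 := by
    intro h; exact one_ne_zero (congrArg Subtype.val h)
  obtain ⟨c, hc⟩ := (finrank_eq_one_iff_of_nonzero' _ h0).1 h1
    ⟨_, (mem_ker_scaledMatrix_iff hF hx.1 hy.1).2 hy⟩
  refine ⟨c, fun a ha => ?_⟩
  have := congrFun (congrArg Subtype.val hc) ⟨a, ha⟩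
  simp only [Submodule.coe_smul, Pi.smul_apply, Pi.one_apply, smul_eq_mul, mul_one] at this
  rw [this, div_mul_cancel₀ _ (monomialValue_ne_zero hx.1 _)]

/-- If there are two monomials more than there are variables, then the values of the monomials at
the roots lie in a pencil. -/
lemma exists_pencil (hcard : A.card = n + 2) (hF : ∀ i, (F i).supp ⊆ (A : Set (Fin n → ℤ)))
    (hfin : (torusZeros F).Finite) {x : Fin n → ℂ_[p]} (hx : x ∈ torusZeros F) :
    ∃ v : (Fin n → ℤ) → ℂ_[p], (∃ a ∈ A, ∃ b ∈ A, v a ≠ v b) ∧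
      ∀ y : Fin n → ℂ_[p], (∀ j, y j ≠ 0) → (y ∈ torusZeros F ↔
        ∃ s t, ∀ a ∈ A, monomialValue y a = (s + t * v a) * monomialValue x a) := by
  classical
  have hli := linearIndependent_of_finite_torusZeros hfin ⟨x, hx⟩
  have h := finrank_ker_scaledMatrix hF hli hx.1
  set W := LinearMap.ker (scaledMatrix A F x).mulVecLin with hW
  have h2 : Module.finrank ℂ_[p] W = 2 := by omega
  set e : W := ⟨1, one_mem_ker_scaledMatrix hF hx⟩ with he
  have hA : Nonempty A := by
    rw [← Fintype.card_pos_iff, Fintype.card_coe]; omega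
  have he0 : e ≠ 0 := by
    intro h; exact one_ne_zero (congrArg Subtype.val h)
  obtain ⟨v, hv⟩ := exists_linearIndependent_pair_of_one_lt_finrank (R := ℂ_[p])
    (by omega : 1 < Module.finrank ℂ_[p] W) he0
  have hspan := hv.span_eq_top_of_card_eq_finrank (by simp [h2])
  refine ⟨fun a => if ha : a ∈ A then v.1 ⟨a, ha⟩ else 0, ?_, fun y hy => ?_⟩
  · by_contra! hcon
    obtain ⟨a₀⟩ := hA
    rw [LinearIndependent.pair_iff] at hv
    have := (hv (-(v.1 a₀)) 1 ?_).2
    · exact one_ne_zero this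
    · ext a
      have := hcon a a.2 a₀ a₀.2
      simp only [a.2, a₀.2, dite_true, Subtype.coe_eta] at this
      simp [he, this]
  · rw [← mem_ker_scaledMatrix_iff hF hx.1 hy, ← hW]
    constructor
    · intro hyW
      have : (⟨_, hyW⟩ : W) ∈ Submodule.span ℂ_[p] (Set.range ![e, v]) := by
        rw [hspan]; trivial
      rw [Matrix.range_cons, Matrix.range_cons, Matrix.range_empty, Set.union_empty,
        Set.singleton_union, Submodule.mem_span_pair] at this
      obtain ⟨s, t, hst⟩ := this
      refine ⟨s, t, fun a ha => ?_⟩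
      have := congrFun (congrArg Subtype.val hst) ⟨a, ha⟩
      simp only [Submodule.coe_add, Submodule.coe_smul, Pi.add_apply, Pi.smul_apply, smul_eq_mul,
        he, Pi.one_apply, mul_one] at this
      simp only [ha, dite_true]
      rw [this, div_mul_cancel₀ _ (monomialValue_ne_zero hx.1 _)]
    · rintro ⟨s, t, hst⟩
      have : (fun a : A => monomialValue y a / monomialValue x a) = s • e.1 + t • v.1 := by
        ext a
        have h3 := hst a a.2
        simp only [a.2, dite_true, Subtype.coe_eta] at h3
        rw [h3, mul_div_cancel_right₀ _ (monomialValue_ne_zero hx.1 _)]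
        simp [he]
      rw [this]
      exact W.add_mem (W.smul_mem _ e.2) (W.smul_mem _ v.2)

end Exponents

end

noncomputable section

/-! ### General position and affine relations -/

/-- A graph in which every edge has an endpoint of degree one has no cycles. -/
lemma SimpleGraph.isAcyclic_of_forall_adj {V : Type*} {G : SimpleGraph V}
    (h : ∀ u v, G.Adj u v → (∀ w, G.Adj u w → w = v) ∨ (∀ w, G.Adj v w → w = u)) :
    G.IsAcyclic := by
  classical
  have key : ∀ (u v : V) (q : G.Walk u u), q.IsCycle → ¬ (∀ w, G.Adj u w → w = v) := by
    intro u v q hq hu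
    refine hq.snd_ne_penultimate ?_
    rw [hu _ (Walk.adj_snd hq.not_nil), hu _ (Walk.adj_penultimate hq.not_nil).symm]
  intro u q hq
  have hadj := Walk.adj_snd hq.not_nil
  rcases h _ _ hadj with h1 | h1
  · exact key u _ q hq h1
  · have hmem : q.snd ∈ q.support := q.getVert_mem_support 1
    exact key q.snd _ _ (hq.rotate hmem) h1

/-- In general position, an affine relation has no vanishing proper partial sums of coefficients. -/
lemma InGeneralPosition.sum_ne_zero {n : ℕ} {A : Finset (Fin n → ℤ)} (hA : InGeneralPosition A)
    (hcard : A.card = n + 2) {m : (Fin n → ℤ) → ℝ} (hm0 : ∑ a ∈ A, m a = 0)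
    (hm1 : ∀ i, ∑ a ∈ A, m a * (a i : ℝ) = 0) (hm : ∃ a ∈ A, m a ≠ 0) {C : Finset (Fin n → ℤ)}
    (hC : C ⊂ A) (hCne : C.Nonempty) : ∑ a ∈ C, m a ≠ 0 := by
  classical
  intro hCm
  obtain ⟨c, hc⟩ := hCne
  obtain ⟨d, hd, hdC⟩ := Finset.exists_of_ssubset hC
  have hcA := hC.1 hc
  have hcd : c ≠ d := fun h => hdC (h ▸ hc)
  set B := (A.erase c).erase d with hB
  have hBcard : B.card = n := by
    rw [hB, Finset.card_erase_of_mem (Finset.mem_erase.2 ⟨hcd.symm, hd⟩),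
      Finset.card_erase_of_mem hcA, hcard]
    omega
  set e : B ≃ Fin n := B.equivFinOfCardEq hBcard with he
  set f : (Fin n → ℤ) → (Fin n → ℤ) := fun a => if a ∈ C then c else d with hf
  set u : Fin n → (Fin n → ℤ) := fun k => (e.symm k : Fin n → ℤ) with hu
  have huB : ∀ k, u k ∈ B := fun k => (e.symm k).2
  have hBA : ∀ a ∈ B, a ∈ A ∧ a ≠ c ∧ a ≠ d := by
    intro a ha
    simp only [hB, Finset.mem_erase] at ha
    exact ⟨ha.2.2, ha.2.1, ha.1⟩
  have hfcd : ∀ a, f a = c ∨ f a = d := by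
    intro a
    simp only [hf]
    split_ifs <;> simp
  have huf : ∀ k a, u k ≠ f a := by
    intro k a h
    rcases hfcd a with h1 | h1
    · exact (hBA _ (huB k)).2.1 (h.trans h1)
    · exact (hBA _ (huB k)).2.2 (h.trans h1)
  have hedge : ∀ k l, s(u k, f (u k)) = s(u l, f (u l)) → u k = u l := by
    intro k l h
    rcases Sym2.eq_iff.1 h with h1 | h1
    · exact h1.1
    · exact absurd h1.1 (huf k _)
  have hadj : ∀ a b, (SimpleGraph.fromEdgeSet (Set.range fun k => s(u k, f (u k)))).Adj a b →
      (∃ k, a = u k ∧ b = f (u k)) ∨ ∃ k, b = u k ∧ a = f (u k) := by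
    intro a b h
    rw [SimpleGraph.fromEdgeSet_adj] at h
    obtain ⟨⟨k, hk⟩, -⟩ := h
    rcases Sym2.eq_iff.1 hk with h1 | h1
    · exact Or.inl ⟨k, h1.1.symm, h1.2.symm⟩
    · exact Or.inr ⟨k, h1.1.symm, h1.2.symm⟩
  have huniq : ∀ k w, (SimpleGraph.fromEdgeSet (Set.range fun k => s(u k, f (u k)))).Adj (u k) w →
      w = f (u k) := by
    intro k w h
    rcases hadj _ _ h with ⟨l, h1, h2⟩ | ⟨l, h1, h2⟩
    · rw [h2, h1]
    · exact absurd h2 (huf k _)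
  have hli := hA u (fun k => f (u k)) (fun k => (hBA _ (huB k)).1)
    (fun k => by rcases hfcd (u k) with h | h <;> rw [h] <;> assumption)
    (fun k => huf k _)
    (fun k l h => e.symm.injective (Subtype.ext (hedge k l h)))
    (SimpleGraph.isAcyclic_of_forall_adj fun a b h => by
      rcases hadj _ _ h with ⟨k, rfl, rfl⟩ | ⟨k, rfl, rfl⟩
      · exact Or.inl (huniq k)
      · exact Or.inr (huniq k))
  rw [Fintype.linearIndependent_iff] at hli
  have hfc : f c = c := by simp [hf, hc]
  have hfd : f d = d := by simp [hf, hdC]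
  have hsumf : ∀ i, ∑ a ∈ A, m a * (f a i : ℝ) = 0 := by
    intro i
    rw [← Finset.sum_sdiff hC.1] at hm0 ⊢
    rw [hCm, add_zero] at hm0
    have h1 : ∑ a ∈ C, m a * (f a i : ℝ) = (∑ a ∈ C, m a) * c i := by
      rw [Finset.sum_mul]
      exact Finset.sum_congr rfl fun a ha => by simp [hf, ha]
    have h2 : ∑ a ∈ A \ C, m a * (f a i : ℝ) = (∑ a ∈ A \ C, m a) * d i := by
      rw [Finset.sum_mul]
      exact Finset.sum_congr rfl fun a ha => by simp [hf, (Finset.mem_sdiff.1 ha).2]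
    rw [h1, h2, hCm, hm0]
    simp
  have hmB : ∀ a ∈ B, m a = 0 := by
    have hmu := hli (fun k => m (u k)) ?_
    · intro a ha
      have := hmu (e ⟨a, ha⟩)
      simpa [hu] using this
    · ext i
      simp only [Finset.sum_apply, Pi.smul_apply, smul_eq_mul, Pi.zero_apply, Int.cast_sub]
      have h1 : ∑ a ∈ A, m a * ((a i : ℝ) - f a i) = 0 := by
        simp only [mul_sub, Finset.sum_sub_distrib, hm1 i, hsumf i, sub_zero]
      rw [← Finset.add_sum_erase A _ hcA, ← Finset.add_sum_erase _ _
        (Finset.mem_erase.2 ⟨hcd.symm, hd⟩), hfc, hfd, sub_self, sub_self, mul_zero, mul_zero,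
        zero_add, zero_add] at h1
      rw [← h1, ← hB, ← Finset.sum_coe_sort B]
      exact Equiv.sum_comp e.symm (fun a : B => m a * (((a : Fin n → ℤ) i : ℝ) - f a i))
  have hmc : m c = 0 := by
    rw [← hCm, Finset.sum_eq_single c]
    · intro a ha hac
      refine hmB a (Finset.mem_erase.2 ⟨fun h => hdC (h ▸ ha), Finset.mem_erase.2 ⟨hac, hC.1 ha⟩⟩)
    · exact fun h => absurd hc h
  have hmd : m d = 0 := by
    rw [← hm0, Finset.sum_eq_single d]
    · intro a ha had
      by_cases hac : a = c
      · rw [hac, hmc]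
      · exact hmB a (Finset.mem_erase.2 ⟨had, Finset.mem_erase.2 ⟨hac, ha⟩⟩)
    · exact fun h => absurd hd h
  obtain ⟨a, ha, ham⟩ := hm
  by_cases hac : a = c
  · exact ham (hac ▸ hmc)
  by_cases had : a = d
  · exact ham (had ▸ hmd)
  exact ham (hmB a (Finset.mem_erase.2 ⟨had, Finset.mem_erase.2 ⟨hac, ha⟩⟩))

/-- More than `n + 1` points of `ℤ^n` satisfy a nontrivial affine relation. -/
lemma exists_affine_relation {n : ℕ} {A : Finset (Fin n → ℤ)} (hcard : A.card = n + 2) :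
    ∃ m : (Fin n → ℤ) → ℝ, ∑ a ∈ A, m a = 0 ∧ (∀ i, ∑ a ∈ A, m a * (a i : ℝ) = 0) ∧
      ∃ a ∈ A, m a ≠ 0 := by
  classical
  set g : (Fin n → ℤ) → (Fin n → ℝ) := fun a i => (a i : ℝ) with hg
  have hinj : Function.Injective g := by
    intro a b h
    ext i
    have := congrFun h i
    simpa [hg] using this
  obtain ⟨f, h1, h2, x, hx, hxf⟩ :=
    Module.exists_nontrivial_relation_sum_zero_of_finrank_succ_lt_card (R := ℝ) (t := A.image g) (by
      rw [Finset.card_image_of_injective _ hinj, hcard, Module.finrank_fintype_fun_eq_card,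
        Fintype.card_fin]
      omega)
  rw [Finset.sum_image fun a _ b _ h => hinj h] at h1 h2
  obtain ⟨a, ha, rfl⟩ := Finset.mem_image.1 hx
  refine ⟨fun a => f (g a), h2, fun i => ?_, a, ha, hxf⟩
  have := congrFun h1 i
  simpa [hg] using this

/-! ### Upper bounds for the number of valuation vectors -/

section UpperBounds

variable {p : ℕ} [hp : Fact p.Prime] {n : ℕ} {A : Finset (Fin n → ℤ)}
  {F : Fin n → LaurentPoly p n}

lemma encard_valuationVectors_eq_zero (hn : 1 ≤ n) (hF : ∀ i, (F i).supp ⊆ (A : Set (Fin n → ℤ)))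
    (hfin : (torusZeros F).Finite) (hcard : A.card ≤ n) : (valuationVectors F).encard = 0 := by
  rw [Set.encard_eq_zero, valuationVectors, Set.image_eq_empty]
  by_contra h
  have := lt_card_of_finite_torusZeros hn hF hfin (Set.nonempty_iff_ne_empty.2 h)
  omega

lemma encard_valuationVectors_le_one (hF : ∀ i, (F i).supp ⊆ (A : Set (Fin n → ℤ)))
    (hfin : (torusZeros F).Finite) (hcard : A.card = n + 1) : (valuationVectors F).encard ≤ 1 := by
  rw [Set.encard_le_one_iff]
  rintro _ _ ⟨x, hx, rfl⟩ ⟨y, hy, rfl⟩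
  obtain ⟨c, hc⟩ := exists_smul_of_card_eq_add_one hcard hF hfin hy hx
  refine ordVec_eq_of_monomials hF hfin ⟨x, hx⟩ hx.1 hy.1 (ordC p c) fun a ha => ?_
  have h0 : c ≠ 0 := by
    rintro rfl
    have := hc a ha
    rw [zero_mul] at this
    exact monomialValue_ne_zero hx.1 a this
  rw [hc a ha, ordC_mul h0 (monomialValue_ne_zero hy.1 a), add_comm]

lemma ordC_eq_neg_log (x : ℂ_[p]) : ordC p x = -(Real.log ‖x‖ / Real.log p) := rfl

lemma sum_mul_ordC_monomialValue {m : (Fin n → ℤ) → ℝ} (hm : ∀ i, ∑ a ∈ A, m a * (a i : ℝ) = 0)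
    {x : Fin n → ℂ_[p]} (hx : ∀ j, x j ≠ 0) :
    ∑ a ∈ A, m a * ordC p (monomialValue x a) = 0 := by
  calc ∑ a ∈ A, m a * ordC p (monomialValue x a)
      = ∑ a ∈ A, ∑ i, (m a * (a i : ℝ)) * ordC p (x i) := by
        refine Finset.sum_congr rfl fun a _ => ?_
        rw [ordC_monomialValue hx, Finset.mul_sum]
        exact Finset.sum_congr rfl fun i _ => (mul_assoc _ _ _).symm
    _ = 0 := by
        rw [Finset.sum_comm]
        refine Finset.sum_eq_zero fun i _ => ?_
        rw [← Finset.sum_mul, hm i, zero_mul]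

/-- In the pencil of monomial values, a root with other valuations than the base point has a
finite parameter. -/
lemma exists_pencil_parameter (hF : ∀ i, (F i).supp ⊆ (A : Set (Fin n → ℤ)))
    (hfin : (torusZeros F).Finite) {x y : Fin n → ℂ_[p]} (hx : x ∈ torusZeros F)
    (hy : y ∈ torusZeros F) (hA : A.Nonempty) {v : (Fin n → ℤ) → ℂ_[p]} {s t : ℂ_[p]}
    (h : ∀ a ∈ A, monomialValue y a = (s + t * v a) * monomialValue x a)
    (hxy : ordVec y ≠ ordVec x) : ∃ z c : ℂ_[p], c ≠ 0 ∧ (∀ a ∈ A, z ≠ v a) ∧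
      ∀ a ∈ A, monomialValue y a = c * (z - v a) * monomialValue x a := by
  have h0 : ∀ a ∈ A, s + t * v a ≠ 0 := by
    intro a ha h0
    have := h a ha
    rw [h0, zero_mul] at this
    exact monomialValue_ne_zero hy.1 a this
  have ht : t ≠ 0 := by
    rintro rfl
    obtain ⟨a₀, ha₀⟩ := hA
    have hs : s ≠ 0 := by simpa using h0 a₀ ha₀
    refine hxy (ordVec_eq_of_monomials hF hfin ⟨x, hx⟩ hy.1 hx.1 (ordC p s) fun a ha => ?_)
    rw [h a ha, zero_mul, add_zero, ordC_mul hs (monomialValue_ne_zero hx.1 a), add_comm]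
  refine ⟨-s / t, -t, neg_ne_zero.2 ht, fun a ha hz => h0 a ha ?_, fun a ha => ?_⟩
  · rw [← hz]; field_simp; ring
  · rw [h a ha]; field_simp; ring

lemma encard_valuationVectors_le_add_one (hF : ∀ i, (F i).supp ⊆ (A : Set (Fin n → ℤ)))
    (hfin : (torusZeros F).Finite) (hcard : A.card = n + 2) (hA : InGeneralPosition A) :
    (valuationVectors F).encard ≤ n + 1 := by
  classical
  rcases (torusZeros F).eq_empty_or_nonempty with h | ⟨x, hx⟩
  · simp [valuationVectors, h]
  obtain ⟨m, hm0, hm1, hm⟩ := exists_affine_relation hcard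
  obtain ⟨v, -, hv⟩ := exists_pencil hcard hF hfin hx
  have hAne : A.Nonempty := Finset.card_pos.1 (by omega)
  have hVfin : (valuationVectors F).Finite := hfin.image _
  set V := hVfin.toFinset.erase (ordVec x) with hV
  have hex : ∀ w ∈ V, ∃ (y : Fin n → ℂ_[p]) (z c : ℂ_[p]), y ∈ torusZeros F ∧ ordVec y = w ∧
      c ≠ 0 ∧ (∀ a ∈ A, z ≠ v a) ∧
      ∀ a ∈ A, monomialValue y a = c * (z - v a) * monomialValue x a := by
    intro w hw
    rw [hV, Finset.mem_erase, Set.Finite.mem_toFinset] at hw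
    obtain ⟨hwx, y, hy, rfl⟩ := hw
    obtain ⟨s, t, hst⟩ := (hv y hy.1).1 hy
    obtain ⟨z, c, h⟩ := exists_pencil_parameter hF hfin hx hy hAne hst hwx
    exact ⟨y, z, c, hy, rfl, h⟩
  choose! y z c hy hyw hc hz hyz using hex
  have hord : ∀ w ∈ V, ∀ a ∈ A, ordC p (monomialValue (y w) a) =
      ordC p (z w - v a) + (ordC p (c w) + ordC p (monomialValue x a)) := by
    intro w hw a ha
    have h1 := sub_ne_zero.2 (hz w hw a ha)
    rw [hyz w hw a ha, ordC_mul (mul_ne_zero (hc w hw) h1) (monomialValue_ne_zero hx.1 a),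
      ordC_mul (hc w hw) h1]
    ring
  have hsame : ∀ w ∈ V, ∀ w' ∈ V, (∀ a ∈ A, ‖z w - v a‖ = ‖z w' - v a‖) → w = w' := by
    intro w hw w' hw' h
    rw [← hyw w hw, ← hyw w' hw']
    refine ordVec_eq_of_monomials hF hfin ⟨x, hx⟩ (hy w hw).1 (hy w' hw').1
      (ordC p (c w) - ordC p (c w')) fun a ha => ?_
    rw [hord w hw a ha, hord w' hw' a ha, (ordC_eq_iff (sub_ne_zero.2 (hz w hw a ha))
      (sub_ne_zero.2 (hz w' hw' a ha))).2 (h a ha)]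
    ring
  have hcardV : (V.image z).card + 2 ≤ A.card := by
    refine card_zero_level_le v m A (by omega) hm0
      (fun C hC hCne => hA.sum_ne_zero hcard hm0 hm1 hm hC hCne) (V.image z) ?_ ?_ ?_ ?_
    · intro _ h
      obtain ⟨w, hw, rfl⟩ := Finset.mem_image.1 h
      exact hz w hw
    · intro _ h
      obtain ⟨w, hw, rfl⟩ := Finset.mem_image.1 h
      have h1 := sum_mul_ordC_monomialValue hm1 (hy w hw).1
      rw [Finset.sum_congr rfl fun a ha => by rw [hord w hw a ha]] at h1
      simp only [mul_add, Finset.sum_add_distrib, ← Finset.sum_mul, hm0, zero_mul,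
        add_zero, sum_mul_ordC_monomialValue hm1 hx.1] at h1
      have hlog : Real.log p ≠ 0 := (Real.log_pos one_lt_natCast_prime).ne'
      have h2 : ∑ a ∈ A, m a * Real.log ‖z w - v a‖ =
          -Real.log p * ∑ a ∈ A, m a * ordC p (z w - v a) := by
        rw [Finset.mul_sum]
        refine Finset.sum_congr rfl fun a _ => ?_
        rw [ordC_eq_neg_log]
        field_simp
      rw [h2, h1, mul_zero]
    · intro _ h
      obtain ⟨w, hw, rfl⟩ := Finset.mem_image.1 h
      by_contra! hcon
      obtain ⟨a₀, ha₀⟩ := hAne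
      have hwx : w ≠ ordVec x := (Finset.mem_erase.1 hw).1
      refine hwx ?_
      rw [← hyw w hw]
      refine ordVec_eq_of_monomials hF hfin ⟨x, hx⟩ (hy w hw).1 hx.1
        (ordC p (z w - v a₀) + ordC p (c w)) fun a ha => ?_
      rw [hord w hw a ha, (ordC_eq_iff (sub_ne_zero.2 (hz w hw a ha))
        (sub_ne_zero.2 (hz w hw a₀ ha₀))).2 (hcon a ha a₀ ha₀)]
      ring
    · intro _ h _ h' heq
      obtain ⟨w, hw, rfl⟩ := Finset.mem_image.1 h
      obtain ⟨w', hw', rfl⟩ := Finset.mem_image.1 h'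
      rw [hsame w hw w' hw' heq]
  rw [Finset.card_image_of_injOn (fun w hw w' hw' h =>
    hsame w hw w' hw' fun a _ => by rw [h]), hcard] at hcardV
  have hle : hVfin.toFinset.card ≤ V.card + 1 := by
    rw [hV]
    exact Nat.sub_le_iff_le_add.1 Finset.pred_card_le_card_erase
  rw [hVfin.encard_eq_coe_toFinset_card]
  exact_mod_cast (by omega : hVfin.toFinset.card ≤ n + 1)

lemma add_one_le_max_div_two_pow (hn : 1 ≤ n) : n + 1 ≤ max 2 ((n / 2) ^ n + n) := by
  rcases Nat.lt_or_ge n 2 with h | h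
  · exact le_max_of_le_left (by omega)
  · refine le_max_of_le_right ?_
    have : 1 ≤ (n / 2) ^ n := Nat.one_le_pow _ _ (by omega)
    omega

end UpperBounds

end

noncomputable section

/-! ### Tropical hypersurfaces and transversality -/

section Tropical

variable {p : ℕ} [hp : Fact p.Prime] {n : ℕ}

lemma exists_pow_eq_of_ne_zero {c : ℂ_[p]} (hc : c ≠ 0) {k : ℕ} (hk : k ≠ 0) :
    ∃ y : ℂ_[p], y ≠ 0 ∧ y ^ k = c := by
  obtain ⟨y, hy⟩ := IsAlgClosed.exists_pow_nat_eq c (Nat.pos_of_ne_zero hk)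
  refine ⟨y, ?_, hy⟩
  rintro rfl
  rw [zero_pow hk] at hy
  exact hc hy.symm

lemma exists_zpow_eq_of_ne_zero {c : ℂ_[p]} (hc : c ≠ 0) {m : ℤ} (hm : m ≠ 0) :
    ∃ y : ℂ_[p], y ≠ 0 ∧ y ^ m = c := by
  have hk : m.natAbs ≠ 0 := Int.natAbs_ne_zero.2 hm
  rcases Int.natAbs_eq m with h | h
  · obtain ⟨y, hy0, hy⟩ := exists_pow_eq_of_ne_zero hc hk
    exact ⟨y, hy0, by rw [h, zpow_natCast, hy]⟩
  · obtain ⟨y, hy0, hy⟩ := exists_pow_eq_of_ne_zero (inv_ne_zero hc) hk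
    exact ⟨y, hy0, by rw [h, zpow_neg, zpow_natCast, hy, inv_inv]⟩

lemma exists_ordC_eq_ratCast (q : ℚ) : ∃ x : ℂ_[p], x ≠ 0 ∧ ordC p x = q := by
  obtain ⟨x, hx0, hx⟩ := exists_pow_eq_of_ne_zero
    (zpow_ne_zero q.num (natCast_prime_ne_zero (p := p))) q.den_ne_zero
  refine ⟨x, hx0, ?_⟩
  have h := congrArg (ordC p) hx
  rw [ordC_pow, ordC_zpow, ordC_natCast_prime, mul_one] at h
  have hd : (q.den : ℝ) ≠ 0 := by exact_mod_cast q.den_ne_zero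
  rw [Rat.cast_def, eq_div_iff hd, mul_comm]
  exact h

lemma dense_ordVec : Dense (ordVec '' {x : Fin n → ℂ_[p] | ∀ j, x j ≠ 0}) := by
  have h1 : Dense (Set.pi Set.univ fun _ : Fin n => Set.range ((↑) : ℚ → ℝ)) :=
    dense_pi _ fun _ _ => Rat.denseRange_cast
  refine h1.mono fun w hw => ?_
  choose q hq using fun i => hw i (Set.mem_univ i)
  choose x hx0 hx using fun i => exists_ordC_eq_ratCast (p := p) (q i)
  exact ⟨x, hx0, funext fun i => (hx i).trans (hq i)⟩

lemma mem_tropicalSet_of_continuousAt {f : LaurentPoly p n} {w : Fin n → ℝ}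
    (Φ : (Fin n → ℝ) → (Fin n → ℝ)) (hΦ : ContinuousAt Φ w) (hw : Φ w = w)
    (h : ∀ᶠ u in 𝓝 w, ∀ x : Fin n → ℂ_[p], (∀ j, x j ≠ 0) → ordVec x = u →
      ∃ y : Fin n → ℂ_[p], (∀ j, y j ≠ 0) ∧ f.evalAt y = 0 ∧ ordVec y = Φ u) :
    w ∈ tropicalSet f := by
  rw [tropicalSet, mem_closure_iff_frequently]
  have h1 := mem_closure_iff_frequently.1 (dense_ordVec (p := p) w)
  have h2 : ∃ᶠ u in 𝓝 w, Φ u ∈ valuationVectors (fun _ : Unit => f) := by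
    refine (h1.and_eventually h).mono ?_
    rintro u ⟨⟨x, hx, hxu⟩, hu⟩
    obtain ⟨y, hy, hyf, hyu⟩ := hu x hx hxu
    exact ⟨y, ⟨hy, fun _ => hyf⟩, hyu⟩
  have h3 : Filter.Tendsto Φ (𝓝 w) (𝓝 w) := by
    have := hΦ.tendsto
    rwa [hw] at this
  exact h3.frequently h2

lemma sum_finrank_quotient_ker {E : Type*} [AddCommGroup E] [Module ℝ E] [FiniteDimensional ℝ E]
    (hE : Module.finrank ℝ E = n) (L : Fin n → E →ₗ[ℝ] ℝ)
    (hL : ∀ u, (∀ i, L i u = 0) → u = 0) :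
    ∑ i, Module.finrank ℝ (E ⧸ LinearMap.ker (L i)) =
      Module.finrank ℝ (E ⧸ (⨅ i, LinearMap.ker (L i))) := by
  have hbot : (⨅ i, LinearMap.ker (L i)) = ⊥ := by
    rw [eq_bot_iff]
    intro u hu
    rw [Submodule.mem_iInf] at hu
    exact hL u hu
  have h1 : ∀ i, Module.finrank ℝ (E ⧸ LinearMap.ker (L i)) ≤ 1 := by
    intro i
    rw [(L i).quotKerEquivRange.finrank_eq]
    simpa using Submodule.finrank_le (LinearMap.range (L i))
  have h2 : n ≤ ∑ i, Module.finrank ℝ (E ⧸ LinearMap.ker (L i)) := by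
    rw [← Module.finrank_pi_fintype]
    refine hE.symm.le.trans (LinearMap.finrank_le_finrank_of_injective
      (f := LinearMap.pi fun i => (LinearMap.ker (L i)).mkQ) ?_)
    rw [← LinearMap.ker_eq_bot, eq_bot_iff]
    intro u hu
    refine hL u fun i => ?_
    have := congrFun (LinearMap.mem_ker.1 hu) i
    simpa using this
  have h3 : Module.finrank ℝ (E ⧸ (⨅ i, LinearMap.ker (L i))) = n := by
    rw [hbot, (Submodule.quotEquivOfEqBot ⊥ rfl).finrank_eq, hE]
  rw [h3]
  refine le_antisymm ?_ h2
  simpa using Finset.sum_le_sum fun i (_ : i ∈ Finset.univ) => h1 i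

/-- Sets which agree near each common point with hyperplanes in general position intersect
transversally. -/
lemma intersectTransversally_of_hyperplanes {T : Fin n → Set (Fin n → ℝ)}
    (h : ∀ w : Fin n → ℝ, (∀ i, w ∈ T i) → ∃ L : Fin n → (Fin n → ℝ) →ₗ[ℝ] ℝ,
      (∀ u, (∀ i, L i u = 0) → u = 0) ∧ ∀ i, ∀ᶠ x in 𝓝 w, x ∈ T i ↔ L i (x - w) = 0) :
    IntersectTransversally T := by
  intro w hw
  obtain ⟨L, hL, hT⟩ := h w hw
  exact ⟨fun i => LinearMap.ker (L i), hT, sum_finrank_quotient_ker (by simp) L hL⟩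

end Tropical

/-! ### Binomial systems -/

section Binomial

variable {p : ℕ} [hp : Fact p.Prime] {n : ℕ}

/-- The pairing with an integral vector, as a linear functional. -/
def pairing (m : Fin n → ℤ) : (Fin n → ℝ) →ₗ[ℝ] ℝ :=
  ∑ i, (m i : ℝ) • LinearMap.proj i

lemma pairing_apply (m : Fin n → ℤ) (w : Fin n → ℝ) : pairing m w = ∑ i, (m i : ℝ) * w i := by
  simp [pairing]

lemma ordC_monomialValue_eq_pairing {x : Fin n → ℂ_[p]} (hx : ∀ j, x j ≠ 0) (a : Fin n → ℤ) :
    ordC p (monomialValue x a) = pairing a (ordVec x) := by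
  rw [ordC_monomialValue hx, pairing_apply]
  rfl

/-- The binomial `x ^ b - x ^ a`. -/
def binomial (p : ℕ) [Fact p.Prime] (a b : Fin n → ℤ) : LaurentPoly p n :=
  AddMonoidAlgebra.single b 1 - AddMonoidAlgebra.single a 1

lemma LaurentPoly.evalLin_single (x : Fin n → ℂ_[p]) (a : Fin n → ℤ) (c : ℂ_[p]) :
    LaurentPoly.evalLin x (AddMonoidAlgebra.single a c) = c * monomialValue x a := by
  simp [LaurentPoly.evalLin]

lemma evalAt_binomial (a b : Fin n → ℤ) (x : Fin n → ℂ_[p]) :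
    (binomial p a b).evalAt x = monomialValue x b - monomialValue x a := by
  rw [← LaurentPoly.evalLin_apply, binomial, map_sub, LaurentPoly.evalLin_single,
    LaurentPoly.evalLin_single, one_mul, one_mul]

lemma evalAt_binomial_eq_zero_iff (a b : Fin n → ℤ) {x : Fin n → ℂ_[p]} (hx : ∀ j, x j ≠ 0) :
    (binomial p a b).evalAt x = 0 ↔ monomialValue x (b - a) = 1 := by
  rw [evalAt_binomial, monomialValue_sub hx, sub_eq_zero,
    div_eq_one_iff_eq (monomialValue_ne_zero hx a)]

lemma supp_binomial_subset {a b : Fin n → ℤ} {A : Finset (Fin n → ℤ)} (ha : a ∈ A) (hb : b ∈ A) :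
    (binomial p a b).supp ⊆ (A : Set (Fin n → ℤ)) := by
  classical
  intro c hc
  by_contra hcA
  have h1 : b ≠ c := fun h => hcA (h ▸ hb)
  have h2 : a ≠ c := fun h => hcA (h ▸ ha)
  refine hc ?_
  change (Finsupp.single b (1 : ℂ_[p]) - Finsupp.single a 1 : (Fin n → ℤ) →₀ ℂ_[p]) c = 0
  simp [h1, h2]

lemma tropicalSet_binomial {a b : Fin n → ℤ} (hab : a ≠ b) :
    tropicalSet (binomial p a b) = {w | pairing (b - a) w = 0} := by
  classical
  apply Set.Subset.antisymm
  · refine closure_minimal ?_ (isClosed_eq (LinearMap.continuous_of_finiteDimensional _)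
      continuous_const)
    rintro _ ⟨x, ⟨hx, hxf⟩, rfl⟩
    have h1 := (evalAt_binomial_eq_zero_iff a b hx).1 (hxf ())
    rw [Set.mem_ofPred_eq, ← ordC_monomialValue_eq_pairing hx, h1, ordC_one]
  · intro w hw
    obtain ⟨j, hj⟩ := Function.ne_iff.1 (sub_ne_zero.2 hab.symm)
    set m := b - a with hm
    have hj' : (m j : ℝ) ≠ 0 := by exact_mod_cast hj
    refine mem_tropicalSet_of_continuousAt
      (fun u => Function.update u j (-(∑ i ∈ Finset.univ.erase j, (m i : ℝ) * u i) / m j)) ?_ ?_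
      (Filter.Eventually.of_forall ?_)
    · refine Continuous.continuousAt ?_
      refine continuous_id.update j ?_
      fun_prop
    · rw [Set.mem_ofPred_eq, pairing_apply, ← Finset.add_sum_erase _ _ (Finset.mem_univ j)] at hw
      rw [Function.update_eq_self_iff, div_eq_iff hj']
      linarith
    · rintro u x hx rfl
      have hc : (∏ i ∈ Finset.univ.erase j, x i ^ m i) ≠ 0 :=
        Finset.prod_ne_zero_iff.2 fun i _ => zpow_ne_zero _ (hx i)
      obtain ⟨y, hy0, hy⟩ := exists_zpow_eq_of_ne_zero (inv_ne_zero hc) hj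
      have hx' : ∀ k, Function.update x j y k ≠ 0 := by
        intro k
        by_cases hk : k = j
        · rw [hk, Function.update_self]; exact hy0
        · rw [Function.update_of_ne hk]; exact hx k
      refine ⟨Function.update x j y, hx', ?_, ?_⟩
      · have h1 : ∏ i ∈ Finset.univ.erase j, Function.update x j y i ^ m i =
            ∏ i ∈ Finset.univ.erase j, x i ^ m i := Finset.prod_congr rfl fun i hi => by
          rw [Function.update_of_ne (Finset.ne_of_mem_erase hi)]
        rw [evalAt_binomial_eq_zero_iff a b hx', monomialValue,
          ← Finset.mul_prod_erase _ _ (Finset.mem_univ j), Function.update_self, ← hm, hy, h1,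
          inv_mul_cancel₀ hc]
      · ext k
        by_cases hk : k = j
        · subst hk
          simp only [ordVec, Function.update_self]
          have h1 := congrArg (ordC p) hy
          rw [ordC_zpow, ordC_inv, ordC_prod _ fun i _ => zpow_ne_zero _ (hx i)] at h1
          rw [eq_div_iff hj', mul_comm, h1]
          simp only [ordC_zpow]
        · simp only [ordVec, Function.update_of_ne hk]

/-- The matrix of exponent differences of a binomial system. -/
def differenceMatrix (a b : Fin n → (Fin n → ℤ)) : Matrix (Fin n) (Fin n) ℤ :=
  Matrix.of fun i => b i - a i

lemma one_mem_torusZeros_binomial (a b : Fin n → (Fin n → ℤ)) :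
    (1 : Fin n → ℂ_[p]) ∈ torusZeros fun i => binomial p (a i) (b i) :=
  ⟨fun _ => one_ne_zero, fun i => by
    rw [evalAt_binomial, monomialValue_one, monomialValue_one, sub_self]⟩

lemma finite_torusZeros_binomial {a b : Fin n → (Fin n → ℤ)}
    (h : (differenceMatrix a b).det ≠ 0) :
    (torusZeros fun i => binomial p (a i) (b i)).Finite := by
  classical
  set M := differenceMatrix a b with hM
  have hsub : (torusZeros fun i => binomial p (a i) (b i)) ⊆
      Set.pi Set.univ fun _ : Fin n => {y : ℂ_[p] | y ^ M.det.natAbs = 1} := by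
    rintro x ⟨hx, hxF⟩ j -
    have h1 : ∀ i, monomialValue x (M i) = 1 := fun i =>
      (evalAt_binomial_eq_zero_iff (a i) (b i) hx).1 (hxF i)
    have h2 : ∏ i, monomialValue x (M i) ^ (M.adjugate j i) = x j ^ M.det := by
      have h3 : ∀ k, ∏ i, (x k ^ M i k) ^ M.adjugate j i = x k ^ (M.adjugate * M) j k := by
        intro k
        rw [Matrix.mul_apply]
        have : ∀ s : Finset (Fin n), ∏ i ∈ s, (x k ^ M i k) ^ M.adjugate j i =
            x k ^ ∑ i ∈ s, M.adjugate j i * M i k := by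
          intro s
          induction s using Finset.induction_on with
          | empty => simp
          | insert i s hi ih =>
            rw [Finset.prod_insert hi, Finset.sum_insert hi, ih, zpow_add₀ (hx k), ← zpow_mul,
              mul_comm (M i k)]
        exact this _
      simp only [monomialValue, ← Finset.prod_zpow]
      rw [Finset.prod_comm, Finset.prod_congr rfl fun k _ => h3 k, Matrix.adjugate_mul,
        Finset.prod_eq_single j]
      · simp
      · intro k _ hk
        simp [Matrix.one_apply_ne hk.symm]
      · simp
    simp only [h1, one_zpow, Finset.prod_const_one] at h2
    rw [Set.mem_ofPred_eq]
    rcases Int.natAbs_eq M.det with h4 | h4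
    · rw [← zpow_natCast, ← h4, ← h2]
    · have h5 : ((M.det.natAbs : ℕ) : ℤ) = -M.det := by omega
      rw [← zpow_natCast, h5, zpow_neg, ← h2, inv_one]
  refine Set.Finite.subset (Set.Finite.pi fun _ => ?_) hsub
  have hk : 0 < M.det.natAbs := Int.natAbs_pos.2 h
  refine (Polynomial.nthRootsFinset M.det.natAbs (1 : ℂ_[p])).finite_toSet.subset fun y hy => ?_
  exact (Polynomial.mem_nthRootsFinset hk _).2 hy

lemma tropicallyGeneric_binomial {a b : Fin n → (Fin n → ℤ)}
    (h : (differenceMatrix a b).det ≠ 0) :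
    TropicallyGeneric fun i => binomial p (a i) (b i) := by
  have hab : ∀ i, a i ≠ b i := by
    intro i hi
    refine h (Matrix.det_eq_zero_of_row_eq_zero i fun j => ?_)
    simp [differenceMatrix, hi]
  refine intersectTransversally_of_hyperplanes fun w hw =>
    ⟨fun i => pairing (b i - a i), fun u hu => ?_, fun i => Filter.Eventually.of_forall fun x => ?_⟩
  · have hdet : ((differenceMatrix a b).map ((↑) : ℤ → ℝ)).det ≠ 0 := by
      have := Int.cast_det (R := ℝ) (differenceMatrix a b)
      rw [← this]
      exact_mod_cast h
    refine Matrix.eq_zero_of_mulVec_eq_zero hdet (funext fun i => ?_)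
    have := hu i
    rw [pairing_apply] at this
    exact this
  · have hwi := hw i
    rw [tropicalSet_binomial (hab i)] at hwi ⊢
    rw [Set.mem_ofPred_eq] at hwi ⊢
    rw [map_sub, hwi, sub_zero]

lemma one_le_maxGenericValuations {A : Fin n → Finset (Fin n → ℤ)} {a b : Fin n → (Fin n → ℤ)}
    (h : (differenceMatrix a b).det ≠ 0) (ha : ∀ i, a i ∈ A i) (hb : ∀ i, b i ∈ A i) :
    1 ≤ maxGenericValuations p A := by
  refine le_trans ?_ (le_iSup₂ (f := fun F _ => (valuationVectors F).encard)
    (fun i => binomial p (a i) (b i)) ⟨⟨fun i => supp_binomial_subset (ha i) (hb i),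
      finite_torusZeros_binomial h⟩, tropicallyGeneric_binomial h⟩)
  rw [Set.one_le_encard_iff_nonempty]
  exact ⟨_, 1, one_mem_torusZeros_binomial a b, rfl⟩

end Binomial

/-! ### Extracting binomials from a system -/

lemma LinearIndependent.exists_mem_of_mem_span {K E ι : Type*} [Field K] [AddCommGroup E]
    [Module K E] [Fintype ι] {r : ι → E} (hr : LinearIndependent K r) (S : ι → Set E)
    (hS : ∀ i, r i ∈ Submodule.span K (S i)) :
    ∃ s : ι → E, LinearIndependent K s ∧ ∀ i, s i ∈ S i := by
  classical
  have key : ∀ T : Finset ι, ∃ s : ι → E, LinearIndependent K s ∧ (∀ i ∈ T, s i ∈ S i) ∧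
      ∀ i ∉ T, s i = r i := by
    intro T
    induction T using Finset.induction_on with
    | empty => exact ⟨r, hr, by simp, fun _ _ => rfl⟩
    | insert i T hi ih =>
      obtain ⟨s, hs, hsT, hsr⟩ := ih
      have : ∃ t ∈ S i, t ∉ Submodule.span K (s '' (Set.univ \ {i})) := by
        by_contra! hcon
        have h1 := Submodule.span_le.2 (show S i ⊆ _ from hcon) (hS i)
        rw [← hsr i hi] at h1
        exact (linearIndependent_iff_notMem_span.1 hs i) h1
      obtain ⟨t, htS, ht⟩ := this
      refine ⟨Function.update s i t, ?_, ?_, ?_⟩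
      · rw [Fintype.linearIndependent_iff] at hs ⊢
        intro g hg
        rw [← Finset.add_sum_erase _ _ (Finset.mem_univ i), Function.update_self,
          Finset.sum_congr rfl fun j hj => by
            rw [Function.update_of_ne (Finset.ne_of_mem_erase hj)]] at hg
        have hmem : ∑ j ∈ Finset.univ.erase i, g j • s j ∈
            Submodule.span K (s '' (Set.univ \ {i})) :=
          Submodule.sum_mem _ fun j hj => Submodule.smul_mem _ _
            (Submodule.subset_span ⟨j, by simpa using hj, rfl⟩)
        have hgi : g i = 0 := by
          by_contra hgi
          refine ht ?_
          rw [← Submodule.smul_mem_iff _ hgi, eq_neg_of_add_eq_zero_left hg]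
          exact Submodule.neg_mem _ hmem
        refine hs g ?_
        rw [← Finset.add_sum_erase _ _ (Finset.mem_univ i), hgi, zero_smul]
        rwa [hgi, zero_smul] at hg
      · intro j hj
        by_cases hji : j = i
        · rw [hji, Function.update_self]; exact htS
        · rw [Function.update_of_ne hji]
          exact hsT j ((Finset.mem_insert.1 hj).resolve_left hji)
      · intro j hj
        rw [Finset.mem_insert, not_or] at hj
        rw [Function.update_of_ne hj.1]
        exact hsr j hj.2
  obtain ⟨s, hs, hsS, -⟩ := key Finset.univ
  exact ⟨s, hs, fun i => hsS i (Finset.mem_univ i)⟩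

/-- A vector of coordinate sum zero is a combination of differences of basis vectors of its
support. -/
lemma mem_span_single_sub_single {K ι : Type*} [Field K] [Fintype ι] [DecidableEq ι] {f : ι → K}
    (hf : ∑ i, f i = 0) {s : Set ι} (hs : ∀ i, f i ≠ 0 → i ∈ s) :
    f ∈ Submodule.span K {g : ι → K | ∃ a ∈ s, ∃ b ∈ s, g = Pi.single b 1 - Pi.single a 1} := by
  by_cases h0 : f = 0
  · rw [h0]; exact Submodule.zero_mem _
  obtain ⟨a, ha⟩ := Function.ne_iff.1 h0
  have : f = ∑ b, f b • (Pi.single b 1 - Pi.single a 1 : ι → K) := by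
    simp only [smul_sub, Finset.sum_sub_distrib, ← Finset.sum_smul, hf, zero_smul, sub_zero]
    ext i
    simp [Finset.sum_apply, Pi.single_apply]
  rw [this]
  refine Submodule.sum_mem _ fun b _ => ?_
  by_cases hb : f b = 0
  · rw [hb, zero_smul]; exact Submodule.zero_mem _
  · exact Submodule.smul_mem _ _ (Submodule.subset_span ⟨a, hs a ha, b, hs b hb, rfl⟩)

section Extraction

variable {p : ℕ} [hp : Fact p.Prime] {n : ℕ}

/-- A system in `n + 1` monomials with a nonempty finite set of roots has supports from which a
nondegenerate binomial system can be chosen. -/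
lemma exists_differenceMatrix_det_ne_zero {A : Fin n → Finset (Fin n → ℤ)}
    (hcard : (Finset.univ.biUnion A).card = n + 1) {F : Fin n → LaurentPoly p n}
    (hF : ∀ i, (F i).supp ⊆ (A i : Set (Fin n → ℤ))) (hfin : (torusZeros F).Finite)
    (hne : (torusZeros F).Nonempty) :
    ∃ a b : Fin n → (Fin n → ℤ), (∀ i, a i ∈ A i) ∧ (∀ i, b i ∈ A i) ∧
      (differenceMatrix a b).det ≠ 0 := by
  classical
  set U := Finset.univ.biUnion A with hU
  have hFU : ∀ i, (F i).supp ⊆ (U : Set (Fin n → ℤ)) := fun i c hc =>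
    Finset.mem_coe.2 (Finset.mem_biUnion.2 ⟨i, Finset.mem_univ i, hF i hc⟩)
  obtain ⟨x, hx⟩ := hne
  have hli := linearIndependent_scaledMatrix hFU
    (linearIndependent_of_finite_torusZeros hfin ⟨x, hx⟩) hx.1
  obtain ⟨s, hs, hsS⟩ := hli.exists_mem_of_mem_span
    (fun i => {g : U → ℂ_[p] | ∃ a ∈ {c : U | (c : Fin n → ℤ) ∈ A i},
      ∃ b ∈ {c : U | (c : Fin n → ℤ) ∈ A i}, g = Pi.single b 1 - Pi.single a 1}) (fun i => by
      refine mem_span_single_sub_single ?_ fun c hc => ?_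
      · have := congrFun (LinearMap.mem_ker.1 (one_mem_ker_scaledMatrix hFU hx)) i
        simpa [Matrix.mulVec, dotProduct] using this
      · refine hF i fun h => hc ?_
        simp [Matrix.row, scaledMatrix, h])
  choose a ha b hb hab using hsS
  refine ⟨fun i => a i, fun i => b i, ha, hb, fun hdet => ?_⟩
  obtain ⟨w, hw0, hw⟩ := Matrix.exists_mulVec_eq_zero_iff.2 hdet
  set B : Matrix (Fin n) U ℂ_[p] := Matrix.of s with hB
  have hrank : B.rank = n := by
    have := LinearIndependent.rank_matrix (M := B) hs
    rwa [Fintype.card_fin] at this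
  have hker : Module.finrank ℂ_[p] (LinearMap.ker B.mulVecLin) = 1 := by
    have h2 := LinearMap.finrank_range_add_finrank_ker B.mulVecLin
    rw [← Matrix.rank, hrank, Module.finrank_fintype_fun_eq_card, Fintype.card_coe, hcard] at h2
    omega
  have hmul : ∀ y i, B.mulVec y i = y (b i) - y (a i) := by
    intro y i
    change dotProduct (s i) y = _
    rw [hab, sub_dotProduct, single_one_dotProduct, single_one_dotProduct]
  have h1 : (1 : U → ℂ_[p]) ∈ LinearMap.ker B.mulVecLin := by
    rw [LinearMap.mem_ker, Matrix.mulVecLin_apply]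
    ext i
    rw [hmul]
    simp
  have hy : (fun c : U => ((∑ i, (c : Fin n → ℤ) i * w i : ℤ) : ℂ_[p])) ∈
      LinearMap.ker B.mulVecLin := by
    rw [LinearMap.mem_ker, Matrix.mulVecLin_apply]
    ext i
    rw [hmul, ← Int.cast_sub, ← Finset.sum_sub_distrib]
    have := congrFun hw i
    simp only [Matrix.mulVec, dotProduct, differenceMatrix, Matrix.of_apply, Pi.sub_apply, sub_mul,
      Pi.zero_apply] at this
    rw [this]
    simp
  obtain ⟨u⟩ : Nonempty U := by
    rw [← Fintype.card_pos_iff, Fintype.card_coe]; omega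
  have h0 : (⟨1, h1⟩ : LinearMap.ker B.mulVecLin) ≠ 0 := fun h =>
    one_ne_zero (congrFun (congrArg Subtype.val h) u)
  obtain ⟨c, hc⟩ := (finrank_eq_one_iff_of_nonzero' _ h0).1 hker ⟨_, hy⟩
  have hc' : ∀ d : U, c = ((∑ i, (d : Fin n → ℤ) i * w i : ℤ) : ℂ_[p]) := by
    intro d
    have := congrFun (congrArg Subtype.val hc) d
    simpa using this
  refine hw0 (eq_zero_of_orthogonal_int hFU hfin ⟨x, hx⟩ w (∑ i, (u : Fin n → ℤ) i * w i)
    fun d hd => ?_)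
  exact_mod_cast (hc' ⟨d, hd⟩).symm.trans (hc' u)

lemma det_differenceMatrix_coordinate :
    (differenceMatrix (fun _ : Fin n => 0) fun i => Pi.single i 1).det ≠ 0 := by
  have : differenceMatrix (fun _ : Fin n => 0) (fun i => Pi.single i 1) = 1 := by
    ext i j
    simp [differenceMatrix, Matrix.one_apply, Pi.single_apply, eq_comm]
  rw [this, Matrix.det_one]
  exact one_ne_zero

lemma card_biUnion_coordinateSupports (hn : 1 ≤ n) :
    (Finset.univ.biUnion (coordinateSupports n)).card = n + 1 := by
  classical
  have : Finset.univ.biUnion (coordinateSupports n) =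
      insert 0 (Finset.univ.image fun i : Fin n => (Pi.single i 1 : Fin n → ℤ)) := by
    ext c
    simp only [Finset.mem_biUnion, Finset.mem_univ, true_and, coordinateSupports,
      Finset.mem_insert, Finset.mem_singleton, Finset.mem_image]
    constructor
    · rintro ⟨i, h | h⟩
      · exact Or.inl h
      · exact Or.inr ⟨i, h.symm⟩
    · rintro (h | ⟨i, h⟩)
      · exact ⟨⟨0, hn⟩, Or.inl h⟩
      · exact ⟨i, Or.inr h.symm⟩
  rw [this, Finset.card_insert_of_notMem, Finset.card_image_of_injective, Finset.card_univ,
    Fintype.card_fin]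
  · intro i j hij
    by_contra h
    have := congrFun hij i
    simp [h] at this
  · simp only [Finset.mem_image, Finset.mem_univ, true_and, not_exists]
    intro i h
    have := congrFun h i
    simp at this

end Extraction

end

noncomputable section

/-! ### Chains `x i * x (i + 1)` -/

section Chain

/-- The weight `2` on the even numbers. -/
def evenWeight (i : ℕ) : ℕ := if Even i then 2 else 0

/-- The weight `2` on the odd numbers. -/
def oddWeight (i : ℕ) : ℕ := if Even i then 0 else 2

lemma sum_weights (n : ℕ) : ∑ i ∈ Finset.range n, evenWeight i = n + n % 2 ∧
    ∑ i ∈ Finset.range n, oddWeight i + n % 2 = n := by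
  induction n with
  | zero => simp
  | succ n ih =>
    rw [Finset.sum_range_succ, Finset.sum_range_succ, evenWeight, oddWeight]
    by_cases h : Even n
    · rw [if_pos h, if_pos h]
      have := Nat.even_iff.1 h
      omega
    · rw [if_neg h, if_neg h]
      have := Nat.not_even_iff.1 h
      omega

variable {K : Type*} [Field K]

lemma prod_chain_telescope (x : ℕ → K) (k : ℕ) :
    (∏ i ∈ Finset.range k, (x i * x (i + 1)) ^ evenWeight i) * (if Even k then x k ^ 2 else 1) =
      x 0 ^ 2 * (∏ i ∈ Finset.range k, (x i * x (i + 1)) ^ oddWeight i) *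
        (if Even k then 1 else x k ^ 2) := by
  induction k with
  | zero => simp
  | succ k ih =>
    rw [Finset.prod_range_succ, Finset.prod_range_succ, evenWeight, oddWeight]
    by_cases h : Even k
    · have h' : ¬ Even (k + 1) := by rw [Nat.even_add_one]; simpa using h
      simp only [h, h', if_true, if_false, mul_one, pow_zero] at ih ⊢
      rw [mul_pow, ← mul_assoc, ih]
    · have h' : Even (k + 1) := by rw [Nat.even_add_one]; exact h
      simp only [h, h', if_true, if_false, mul_one, pow_zero] at ih ⊢
      rw [ih, mul_pow]
      ring

lemma exists_chain (Y : ℕ → K) (hY : ∀ i, Y i ≠ 0) (n : ℕ) : ∃ x : ℕ → K, (∀ i, x i ≠ 0) ∧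
    (∀ i < n, x i * x (i + 1) = Y i) ∧ ∀ i, n ≤ i → x i = 1 := by
  set g : ℕ → K := fun k => Nat.rec 1 (fun k y => Y (n - 1 - k) / y) k with hg
  have hg0 : ∀ k, g k ≠ 0 := by
    intro k
    induction k with
    | zero => exact one_ne_zero
    | succ k ih => exact div_ne_zero (hY _) ih
  refine ⟨fun i => g (n - i), fun i => hg0 _, fun i hi => ?_, fun i hi => ?_⟩
  · change g (n - i) * g (n - (i + 1)) = Y i
    have h1 : n - i = (n - (i + 1)) + 1 := by omega
    have h2 : g (n - i) = Y (n - 1 - (n - (i + 1))) / g (n - (i + 1)) := by rw [h1]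
    have h3 : n - 1 - (n - (i + 1)) = i := by omega
    rw [h2, h3, div_mul_cancel₀ _ (hg0 _)]
  · have : n - i = 0 := by omega
    simp [this, hg]

lemma chain_injective {x y : ℕ → K} (hx : ∀ i, x i ≠ 0) {n : ℕ}
    (h : ∀ i < n, x i * x (i + 1) = y i * y (i + 1)) (hn : x n = y n) : ∀ i ≤ n, x i = y i := by
  intro i hi
  induction hi using Nat.decreasingInduction with
  | self => exact hn
  | of_succ k hk ih =>
    have h1 := h k hk
    rw [← ih] at h1
    exact mul_right_cancel₀ (hx _) h1

/-- Scaling all variables of the two sides of the homogenized chain relation. -/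
lemma chain_homogeneous (n : ℕ) (c θz θ₀ : K) (θ : ℕ → K) :
    (c * θz) * (c * θ₀) ^ (n % 2) * ∏ i ∈ Finset.range n, (c * θ i) ^ oddWeight i =
      c ^ (n + 1) * (θz * θ₀ ^ (n % 2) * ∏ i ∈ Finset.range n, θ i ^ oddWeight i) ∧
    (c * θ₀) ^ (1 - n % 2) * ∏ i ∈ Finset.range n, (c * θ i) ^ evenWeight i =
      c ^ (n + 1) * (θ₀ ^ (1 - n % 2) * ∏ i ∈ Finset.range n, θ i ^ evenWeight i) := by
  obtain ⟨h1, h2⟩ := sum_weights n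
  simp only [mul_pow, Finset.prod_mul_distrib, Finset.prod_pow_eq_pow_sum]
  constructor
  · have : n + 1 = 1 + n % 2 + ∑ i ∈ Finset.range n, oddWeight i := by omega
    rw [this, pow_add, pow_add, pow_one]
    ring
  · have : n + 1 = (1 - n % 2) + ∑ i ∈ Finset.range n, evenWeight i := by omega
    rw [this, pow_add]
    ring

open Polynomial in
/-- The polynomial whose roots are the parameters satisfying the chain relation. -/
def chainPolynomial (n : ℕ) (vz v₀ : K) (v : ℕ → K) : K[X] :=
  (X - C vz) * (X - C v₀) ^ (n % 2) * ∏ i ∈ Finset.range n, (X - C (v i)) ^ oddWeight i -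
    (X - C v₀) ^ (1 - n % 2) * ∏ i ∈ Finset.range n, (X - C (v i)) ^ evenWeight i

lemma eval_chainPolynomial (n : ℕ) (vz v₀ : K) (v : ℕ → K) (z : K) :
    (chainPolynomial n vz v₀ v).eval z =
      (z - vz) * (z - v₀) ^ (n % 2) * ∏ i ∈ Finset.range n, (z - v i) ^ oddWeight i -
        (z - v₀) ^ (1 - n % 2) * ∏ i ∈ Finset.range n, (z - v i) ^ evenWeight i := by
  simp [chainPolynomial, Polynomial.eval_prod]

open Polynomial in
lemma degree_chainPolynomial_lt (n : ℕ) (vz v₀ : K) (v : ℕ → K) :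
    (chainPolynomial n vz v₀ v).degree < (n + 1 : ℕ) := by
  obtain ⟨h1, h2⟩ := sum_weights n
  have hmon : ∀ w : ℕ → ℕ, (∏ i ∈ Finset.range n, (X - C (v i)) ^ w i).Monic := fun w =>
    monic_prod_of_monic _ _ fun i _ => (monic_X_sub_C _).pow _
  have hdeg : ∀ w : ℕ → ℕ, (∏ i ∈ Finset.range n, (X - C (v i)) ^ w i).natDegree =
      ∑ i ∈ Finset.range n, w i := by
    intro w
    rw [natDegree_prod_of_monic _ _ fun i _ => (monic_X_sub_C _).pow _]
    simp
  have hm1 : ((X - C vz) * (X - C v₀) ^ (n % 2) *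
      ∏ i ∈ Finset.range n, (X - C (v i)) ^ oddWeight i).Monic :=
    ((monic_X_sub_C _).mul ((monic_X_sub_C _).pow _)).mul (hmon _)
  have hm2 : ((X - C v₀) ^ (1 - n % 2) *
      ∏ i ∈ Finset.range n, (X - C (v i)) ^ evenWeight i).Monic :=
    ((monic_X_sub_C _).pow _).mul (hmon _)
  have hd1 : ((X - C vz) * (X - C v₀) ^ (n % 2) *
      ∏ i ∈ Finset.range n, (X - C (v i)) ^ oddWeight i).natDegree = n + 1 := by
    rw [((monic_X_sub_C _).mul ((monic_X_sub_C _).pow _)).natDegree_mul (hmon _),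
      (monic_X_sub_C _).natDegree_mul ((monic_X_sub_C _).pow _), hdeg,
      (monic_X_sub_C _).natDegree_pow, natDegree_X_sub_C, natDegree_X_sub_C]
    omega
  have hd2 : ((X - C v₀) ^ (1 - n % 2) *
      ∏ i ∈ Finset.range n, (X - C (v i)) ^ evenWeight i).natDegree = n + 1 := by
    rw [((monic_X_sub_C _).pow _).natDegree_mul (hmon _), hdeg,
      (monic_X_sub_C _).natDegree_pow, natDegree_X_sub_C]
    omega
  rw [← hd1, ← degree_eq_natDegree hm1.ne_zero]
  refine degree_sub_lt_left ?_ hm1.ne_zero (by rw [hm1.leadingCoeff, hm2.leadingCoeff])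
  rw [degree_eq_natDegree hm1.ne_zero, degree_eq_natDegree hm2.ne_zero, hd1, hd2]

end Chain

/-! ### The chain supports -/

section ChainSupports

variable {p : ℕ} [hp : Fact p.Prime] {n : ℕ}

/-- The exponent `e_i + e_{i+1}`, where `e_n = 0`. -/
def chainExponent (i : Fin n) : Fin n → ℤ :=
  Pi.single i 1 + if h : i.val + 1 < n then Pi.single ⟨i.val + 1, h⟩ 1 else 0

/-- Extension of a finite sequence by a constant. -/
def extendBy {R : Type*} (d : R) (x : Fin n → R) (k : ℕ) : R :=
  if h : k < n then x ⟨k, h⟩ else d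

lemma extendBy_coe {R : Type*} (d : R) (x : Fin n → R) (i : Fin n) : extendBy d x i = x i := by
  simp [extendBy]

lemma extendBy_of_le {R : Type*} (d : R) (x : Fin n → R) {k : ℕ} (hk : n ≤ k) :
    extendBy d x k = d := by
  simp [extendBy, hk]

lemma extendBy_ne_zero {R : Type*} [Zero R] {d : R} (hd : d ≠ 0) {x : Fin n → R}
    (hx : ∀ j, x j ≠ 0) (k : ℕ) : extendBy d x k ≠ 0 := by
  unfold extendBy
  split_ifs
  · exact hx _
  · exact hd

lemma monomialValue_chainExponent {x : Fin n → ℂ_[p]} (hx : ∀ j, x j ≠ 0) (i : Fin n) :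
    monomialValue x (chainExponent i) = extendBy 1 x i * extendBy 1 x (i + 1) := by
  rw [chainExponent, monomialValue_add hx, monomialValue_single, zpow_one, extendBy_coe, extendBy]
  split_ifs with h
  · rw [monomialValue_single, zpow_one]
  · rw [monomialValue_zero]

lemma chainExponent_apply_self (i : Fin n) : chainExponent i i = 1 := by
  unfold chainExponent
  split_ifs with h
  · have : i ≠ ⟨i.val + 1, h⟩ := fun h' => by simpa using congrArg Fin.val h'
    simp [this]
  · simp

lemma chainExponent_apply_of_lt {i j : Fin n} (hij : i < j) : chainExponent j i = 0 := by
  unfold chainExponent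
  split_ifs with h
  · have : i ≠ ⟨j.val + 1, h⟩ := fun h' => by
      have := congrArg Fin.val h'
      simp only at this
      omega
    simp [this, hij.ne]
  · simp [hij.ne]

lemma chainExponent_injective : Function.Injective (chainExponent (n := n)) := by
  intro i j hij
  rcases lt_trichotomy i j with h | h | h
  · have := chainExponent_apply_of_lt h
    rw [← hij, chainExponent_apply_self] at this
    exact absurd this one_ne_zero
  · exact h
  · have := chainExponent_apply_of_lt h
    rw [hij, chainExponent_apply_self] at this
    exact absurd this one_ne_zero

/-- The union of the chain supports. -/
def chainUnion (hn : 1 ≤ n) : Finset (Fin n → ℤ) :=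
  insert 0 (insert (Pi.single ⟨0, hn⟩ 2) (Finset.univ.image chainExponent))

lemma card_chainUnion (hn : 1 ≤ n) : (chainUnion hn).card = n + 2 := by
  have hle : ∀ i, chainExponent i ⟨0, hn⟩ = 0 ∨ chainExponent i ⟨0, hn⟩ = (1 : ℤ) := by
    intro i
    rcases Nat.eq_zero_or_pos i.val with h | h
    · right
      have : i = ⟨0, hn⟩ := Fin.ext h
      rw [← this, chainExponent_apply_self]
    · left
      exact chainExponent_apply_of_lt (Fin.lt_def.2 h)
  rw [chainUnion, Finset.card_insert_of_notMem, Finset.card_insert_of_notMem,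
    Finset.card_image_of_injective _ chainExponent_injective, Finset.card_univ, Fintype.card_fin]
  · simp only [Finset.mem_image, Finset.mem_univ, true_and, not_exists]
    intro i h
    have h1 := congrFun h ⟨0, hn⟩
    rw [Pi.single_eq_same] at h1
    have := hle i
    omega
  · simp only [Finset.mem_insert, Finset.mem_image, Finset.mem_univ, true_and, not_or, not_exists]
    refine ⟨fun h => ?_, fun i h => ?_⟩
    · have := congrFun h ⟨0, hn⟩
      simp at this
    · have := congrFun h i
      rw [chainExponent_apply_self] at this
      simp at this

lemma forall_mem_chainUnion (hn : 1 ≤ n) {P : (Fin n → ℤ) → Prop} :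
    (∀ a ∈ chainUnion hn, P a) ↔ P 0 ∧ P (Pi.single ⟨0, hn⟩ 2) ∧ ∀ i, P (chainExponent i) := by
  simp [chainUnion]

lemma chainSupports_subset (hn : 1 ≤ n) (i : Fin n) : chainSupports n i ⊆ chainUnion hn := by
  intro a ha
  simp only [chainSupports, Finset.mem_insert, Finset.mem_singleton] at ha
  simp only [chainUnion, Finset.mem_insert, Finset.mem_image, Finset.mem_univ, true_and]
  rcases ha with h | h | h
  · exact Or.inl h
  · exact Or.inr (Or.inl h)
  · exact Or.inr (Or.inr ⟨i, h.symm⟩)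

lemma eq_of_chain_eq {x y : Fin n → ℂ_[p]} (hx : ∀ j, x j ≠ 0) (hy : ∀ j, y j ≠ 0)
    (h : ∀ i, monomialValue x (chainExponent i) = monomialValue y (chainExponent i)) : x = y := by
  ext i
  have := chain_injective (x := extendBy 1 x) (y := extendBy 1 y)
    (extendBy_ne_zero one_ne_zero hx) (n := n) (fun i hi => by
      have := h ⟨i, hi⟩
      rwa [monomialValue_chainExponent hx, monomialValue_chainExponent hy] at this)
    (by rw [extendBy_of_le _ _ le_rfl, extendBy_of_le _ _ le_rfl]) i i.2.le
  rwa [extendBy_coe, extendBy_coe] at this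

/-- The relation between the monomials in the chain supports. -/
lemma chain_relation (hn : 1 ≤ n) {x : Fin n → ℂ_[p]} (hx : ∀ j, x j ≠ 0) :
    ∏ i ∈ Finset.range n, (extendBy 1 (fun i => monomialValue x (chainExponent i)) i) ^ evenWeight i
      = monomialValue x (Pi.single ⟨0, hn⟩ 2) * ∏ i ∈ Finset.range n,
        (extendBy 1 (fun i => monomialValue x (chainExponent i)) i) ^ oddWeight i := by
  have h := prod_chain_telescope (extendBy 1 x) n
  simp only [extendBy_of_le _ _ le_rfl, one_pow, ite_self, mul_one] at h
  have h0 : extendBy 1 x 0 = x ⟨0, hn⟩ := extendBy_coe 1 x ⟨0, hn⟩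
  have h1 : ∀ i ∈ Finset.range n, extendBy 1 (fun i => monomialValue x (chainExponent i)) i =
      extendBy 1 x i * extendBy 1 x (i + 1) := by
    intro i hi
    have := extendBy_coe 1 (fun i => monomialValue x (chainExponent i)) ⟨i, Finset.mem_range.1 hi⟩
    rw [this, monomialValue_chainExponent hx]
  have h2 : ∀ v : ℕ → ℕ, ∏ i ∈ Finset.range n,
      extendBy 1 (fun i => monomialValue x (chainExponent i)) i ^ v i =
        ∏ i ∈ Finset.range n, (extendBy 1 x i * extendBy 1 x (i + 1)) ^ v i :=
    fun v => Finset.prod_congr rfl fun i hi => by rw [h1 i hi]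
  rw [monomialValue_single, h2, h2, h, h0]
  rfl

/-- A point of the torus with prescribed values of the chain monomials. -/
lemma exists_point_of_chain (hn : 1 ≤ n) {Y : Fin n → ℂ_[p]} (hY : ∀ i, Y i ≠ 0) {Z : ℂ_[p]}
    (h : ∏ i ∈ Finset.range n, extendBy 1 Y i ^ evenWeight i =
      Z * ∏ i ∈ Finset.range n, extendBy 1 Y i ^ oddWeight i) :
    ∃ x : Fin n → ℂ_[p], (∀ j, x j ≠ 0) ∧ (∀ i, monomialValue x (chainExponent i) = Y i) ∧
      monomialValue x (Pi.single ⟨0, hn⟩ 2) = Z := by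
  obtain ⟨x, hx0, hxY, hx1⟩ := exists_chain (extendBy 1 Y) (extendBy_ne_zero one_ne_zero hY) n
  have hx' : ∀ j : Fin n, x j ≠ 0 := fun j => hx0 j
  have hext : ∀ k, extendBy 1 (fun j : Fin n => x j) k = x k := by
    intro k
    by_cases hk : k < n
    · exact extendBy_coe 1 (fun j : Fin n => x j) ⟨k, hk⟩
    · rw [extendBy_of_le _ _ (not_lt.1 hk), hx1 k (not_lt.1 hk)]
  have hmon : ∀ i, monomialValue (fun j : Fin n => x j) (chainExponent i) = Y i := by
    intro i
    rw [monomialValue_chainExponent hx', hext, hext, hxY i i.2, extendBy_coe]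
  refine ⟨fun j => x j, hx', hmon, ?_⟩
  have h1 := chain_relation hn hx'
  simp only [hmon] at h1
  rw [h] at h1
  refine (mul_right_cancel₀ (Finset.prod_ne_zero_iff.2 fun i _ => pow_ne_zero _ ?_) h1).symm
  exact extendBy_ne_zero one_ne_zero hY i

/-- The maximal number of roots of a system with chain supports. -/
lemma encard_torusZeros_chain_le (hn : 1 ≤ n) {F : Fin n → LaurentPoly p n}
    (hF : ∀ i, (F i).supp ⊆ (chainUnion hn : Set (Fin n → ℤ))) (hfin : (torusZeros F).Finite) :
    (torusZeros F).encard ≤ n + 1 := by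
  classical
  rcases (torusZeros F).eq_empty_or_nonempty with h | ⟨x, hx⟩
  · simp [h]
  obtain ⟨v, hvne, hv⟩ := exists_pencil (card_chainUnion hn) hF hfin hx
  set a₂ : Fin n → ℤ := Pi.single ⟨0, hn⟩ 2 with ha₂
  set θ : ℕ → ℂ_[p] := extendBy 0 fun i => v (chainExponent i) with hθ
  set Q := chainPolynomial n (v a₂) (v 0) θ with hQ
  -- a root other than `x` has a finite parameter, which is a root of `Q`
  have hroot : ∀ y ∈ torusZeros F, y ≠ x → ∃ c z : ℂ_[p], c ≠ 0 ∧ Q.eval z = 0 ∧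
      ∀ a ∈ chainUnion hn, monomialValue y a = c * (z - v a) * monomialValue x a := by
    intro y hy hyx
    obtain ⟨s, t, hst⟩ := (hv y hy.1).1 hy
    have ht : t ≠ 0 := by
      rintro rfl
      simp only [zero_mul, add_zero] at hst
      have h0 := ((forall_mem_chainUnion hn).1 hst).1
      rw [monomialValue_zero, monomialValue_zero, mul_one] at h0
      refine hyx (eq_of_chain_eq hy.1 hx.1 fun i => ?_)
      rw [((forall_mem_chainUnion hn).1 hst).2.2 i, ← h0, one_mul]
    have hc : ∀ a ∈ chainUnion hn, monomialValue y a = -t * (-s / t - v a) * monomialValue x a := by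
      intro a ha
      rw [hst a ha]
      field_simp
      ring
    refine ⟨-t, -s / t, neg_ne_zero.2 ht, ?_, hc⟩
    set c := -t
    set z := -s / t
    have hq : ∀ j, (y / x) j ≠ 0 := fun j => div_ne_zero (hy.1 j) (hx.1 j)
    have hyq : y = (y / x) * x := by
      ext j
      simp [hx.1 j]
    have hqa : ∀ a ∈ chainUnion hn, monomialValue (y / x) a = c * (z - v a) := by
      intro a ha
      have := hc a ha
      rw [hyq, monomialValue_mul] at this
      exact mul_right_cancel₀ (monomialValue_ne_zero hx.1 a) this
    obtain ⟨hq0, hq2, hqi⟩ := (forall_mem_chainUnion hn).1 hqa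
    rw [monomialValue_zero] at hq0
    have hrel := chain_relation hn hq
    have hterm : ∀ w : ℕ → ℕ, ∏ i ∈ Finset.range n,
        extendBy 1 (fun i => monomialValue (y / x) (chainExponent i)) i ^ w i =
          ∏ i ∈ Finset.range n, (c * (z - θ i)) ^ w i := by
      refine fun w => Finset.prod_congr rfl fun i hi => ?_
      have h1 := extendBy_coe 1 (fun i => monomialValue (y / x) (chainExponent i))
        ⟨i, Finset.mem_range.1 hi⟩
      have h2 := extendBy_coe 0 (fun i => v (chainExponent i)) ⟨i, Finset.mem_range.1 hi⟩
      rw [h1, hqi, hθ, h2]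
    rw [hq2, hterm, hterm] at hrel
    have hhom := chain_homogeneous n c (z - v a₂) (z - v 0) fun i => z - θ i
    rw [← hq0, one_pow, one_pow, mul_one, one_mul, hrel] at hhom
    rw [hQ, eval_chainPolynomial, sub_eq_zero]
    exact mul_left_cancel₀ (pow_ne_zero (n + 1) (neg_ne_zero.2 ht)) (hhom.1.symm.trans hhom.2)
  have hQ0 : Q ≠ 0 := by
    intro hQ0
    have hinf : ((((chainUnion hn).image v : Finset ℂ_[p]) : Set ℂ_[p])ᶜ).Infinite :=
      (Finset.finite_toSet _).infinite_compl
    have hex : ∀ z ∈ (((chainUnion hn).image v : Finset ℂ_[p]) : Set ℂ_[p])ᶜ,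
        ∃ y ∈ torusZeros F, ∀ a ∈ chainUnion hn,
          monomialValue y a * (z - v 0) = (z - v a) * monomialValue x a := by
      intro z hz
      have hz' : ∀ a ∈ chainUnion hn, z - v a ≠ 0 := by
        intro a ha h
        exact hz (Finset.mem_coe.2 (Finset.mem_image.2 ⟨a, ha, (sub_eq_zero.1 h).symm⟩))
      obtain ⟨hz0, hz2, hzi⟩ := (forall_mem_chainUnion hn).1 hz'
      have hev : Q.eval z = 0 := by rw [hQ0, Polynomial.eval_zero]
      rw [hQ, eval_chainPolynomial, sub_eq_zero] at hev
      set c := (z - v 0)⁻¹ with hc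
      have hc0 : c * (z - v 0) = 1 := inv_mul_cancel₀ hz0
      have hcne : c ≠ 0 := inv_ne_zero hz0
      have hhom := chain_homogeneous n c (z - v a₂) (z - v 0) fun i => z - θ i
      rw [hev, hc0, one_pow, one_pow, mul_one, one_mul] at hhom
      have hrel := hhom.2.trans hhom.1.symm
      have hterm : ∀ w : ℕ → ℕ, ∏ i ∈ Finset.range n, (c * (z - θ i)) ^ w i =
          ∏ i ∈ Finset.range n, extendBy 1 (fun i => c * (z - v (chainExponent i))) i ^ w i := by
        refine fun w => Finset.prod_congr rfl fun i hi => ?_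
        have h1 := extendBy_coe 1 (fun i => c * (z - v (chainExponent i)))
          ⟨i, Finset.mem_range.1 hi⟩
        have h2 := extendBy_coe 0 (fun i => v (chainExponent i)) ⟨i, Finset.mem_range.1 hi⟩
        rw [h1, hθ, h2]
      rw [hterm, hterm] at hrel
      obtain ⟨q, hq, hqi, hq2⟩ := exists_point_of_chain hn
        (fun i => mul_ne_zero hcne (hzi i)) hrel
      have hqa : ∀ a ∈ chainUnion hn, monomialValue q a = c * (z - v a) :=
        (forall_mem_chainUnion hn).2 ⟨by rw [monomialValue_zero, hc0], hq2, hqi⟩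
      have hqx : ∀ j, (q * x) j ≠ 0 := fun j => mul_ne_zero (hq j) (hx.1 j)
      refine ⟨q * x, (hv _ hqx).2 ⟨c * z, -c, fun a ha => ?_⟩, fun a ha => ?_⟩
      · rw [monomialValue_mul, hqa a ha]
        ring
      · rw [monomialValue_mul, hqa a ha]
        linear_combination (z - v a) * monomialValue x a * hc0
    choose! y hy hya using hex
    refine Set.infinite_of_injOn_mapsTo (f := y) ?_ (fun z hz => hy z hz) hinf hfin
    intro z hz z' hz' hzz
    obtain ⟨b, hb, hb0⟩ : ∃ b ∈ chainUnion hn, v b ≠ v 0 := by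
      by_contra! hcon
      obtain ⟨a, ha, b, hb, hab⟩ := hvne
      exact hab ((hcon a ha).trans (hcon b hb).symm)
    have h1 := hya z hz b hb
    have h2 := hya z' hz' b hb
    rw [hzz] at h1
    have hm := monomialValue_ne_zero hx.1 b
    have h3 : (z - z') * (v b - v 0) * monomialValue x b = 0 := by
      linear_combination (z - v 0) * h2 - (z' - v 0) * h1
    have h4 := (mul_eq_zero.1 ((mul_eq_zero.1 h3).resolve_right hm)).resolve_right
      (sub_ne_zero.2 hb0)
    exact sub_eq_zero.1 h4
  have hdeg : Q.roots.toFinset.card ≤ n := by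
    refine (Multiset.toFinset_card_le _).trans ((Polynomial.card_roots' Q).trans ?_)
    have h1 := degree_chainPolynomial_lt n (v a₂) (v 0) θ
    rw [← hQ, Polynomial.degree_eq_natDegree hQ0] at h1
    have h2 : Q.natDegree < n + 1 := by exact_mod_cast h1
    omega
  choose! c z hc hz hyz using hroot
  have hcard : (hfin.toFinset.erase x).card ≤ n := by
    refine le_trans (Finset.card_le_card_of_injOn z (fun y hy => ?_) ?_) hdeg
    · have hy' := Finset.mem_erase.1 (Finset.mem_coe.1 hy)
      rw [Finset.mem_coe, Multiset.mem_toFinset, Polynomial.mem_roots hQ0]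
      exact hz y ((Set.Finite.mem_toFinset _).1 hy'.2) hy'.1
    · intro y hy y' hy' hzz
      have hy1 := Finset.mem_erase.1 (Finset.mem_coe.1 hy)
      have hy2 := Finset.mem_erase.1 (Finset.mem_coe.1 hy')
      rw [Set.Finite.mem_toFinset] at hy1 hy2
      obtain ⟨h0, -, h1⟩ := (forall_mem_chainUnion hn).1 (hyz y hy1.2 hy1.1)
      obtain ⟨h0', -, h1'⟩ := (forall_mem_chainUnion hn).1 (hyz y' hy2.2 hy2.1)
      rw [monomialValue_zero, monomialValue_zero, mul_one] at h0 h0'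
      rw [← hzz] at h0' h1'
      have hcc : c y = c y' := by
        have hne : z y - v 0 ≠ 0 := by
          intro h
          rw [h, mul_zero] at h0
          exact one_ne_zero h0
        exact mul_right_cancel₀ hne (h0.symm.trans h0')
      exact eq_of_chain_eq hy1.2.1 hy2.2.1 fun i => by rw [h1 i, h1' i, hcc]
  have hle : hfin.toFinset.card ≤ (hfin.toFinset.erase x).card + 1 :=
    Nat.sub_le_iff_le_add.1 Finset.pred_card_le_card_erase
  rw [hfin.encard_eq_coe_toFinset_card]
  exact_mod_cast hle.trans (Nat.add_le_add_right hcard 1)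

end ChainSupports

end

noncomputable section

/-! ### Roots of polynomials on a circle -/

section Circle

lemma exists_root_of_norm_eval_ne {K : Type*} [NormedField K] [IsUltrametricDist K] [IsAlgClosed K]
    {P : Polynomial K} {z₁ z₂ : K} (hz : ‖z₁‖ = ‖z₂‖) (h : ‖P.eval z₁‖ ≠ ‖P.eval z₂‖) :
    ∃ ζ, P.eval ζ = 0 ∧ ‖ζ‖ = ‖z₁‖ := by
  by_contra! hcon
  have hP : P ≠ 0 := by
    rintro rfl
    simp at h
  have key : ∀ z, ‖z‖ = ‖z₁‖ → ‖P.eval z‖ =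
      ‖P.leadingCoeff‖ * (P.roots.map fun ζ => max ‖z₁‖ ‖ζ‖).prod := by
    intro z hzz
    rw [(IsAlgClosed.splits P).eval_eq_prod_roots, norm_mul]
    congr 1
    rw [← coe_nnnorm, ← nnnormHom_apply, map_multiset_prod, NNReal.coe_multiset_prod,
      Multiset.map_map, Multiset.map_map]
    congr 1
    refine Multiset.map_congr rfl fun ζ hζ => ?_
    have hne := hcon ζ (Polynomial.isRoot_of_mem_roots hζ)
    simp only [Function.comp_apply, nnnormHom_apply, coe_nnnorm]
    rw [sub_eq_add_neg, IsUltrametricDist.norm_add_eq_max_of_norm_ne_norm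
      (by rw [norm_neg, hzz]; exact hne.symm), norm_neg, hzz]
  exact h ((key z₁ rfl).trans (key z₂ hz.symm).symm)

/-- An element whose residue class is different from `0` and `1`. -/
lemma exists_norm_eq_one_and_norm_sub_one_eq_one (K : Type*) [NormedField K] [IsUltrametricDist K]
    [IsAlgClosed K] : ∃ u : K, ‖u‖ = 1 ∧ ‖u - 1‖ = 1 := by
  have hdeg : (Polynomial.X ^ 2 - Polynomial.X + 1 : Polynomial K).degree ≠ 0 := by
    have : (Polynomial.X ^ 2 - Polynomial.X + 1 : Polynomial K).degree = 2 := by compute_degree!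
    rw [this]; exact two_ne_zero
  obtain ⟨u, hu⟩ := IsAlgClosed.exists_root _ hdeg
  have h1 : u * (u - 1) = -1 := by
    have : u ^ 2 - u + 1 = 0 := by simpa [Polynomial.IsRoot] using hu
    linear_combination this
  have h2 : ‖u‖ * ‖u - 1‖ = 1 := by rw [← norm_mul, h1, norm_neg, norm_one]
  by_cases h : ‖u‖ = 1
  · exact ⟨u, h, by rwa [h, one_mul] at h2⟩
  · have h3 : ‖u - 1‖ = max ‖u‖ 1 := by
      rw [sub_eq_add_neg, IsUltrametricDist.norm_add_eq_max_of_norm_ne_norm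
        (by rwa [norm_neg, norm_one]), norm_neg, norm_one]
    rw [h3] at h2
    rcases lt_or_gt_of_ne h with h4 | h4
    · rw [max_eq_right h4.le, mul_one] at h2
      exact absurd h2 h
    · rw [max_eq_left h4.le] at h2
      nlinarith

variable {K : Type*} [NormedField K] [IsUltrametricDist K]

lemma norm_eq_one_of_norm_sub_one_lt {x : K} (hx : ‖x - 1‖ < 1) : ‖x‖ = 1 := by
  have := IsUltrametricDist.norm_add_eq_max_of_norm_ne_norm (x := x - 1) (y := 1)
    (by rw [norm_one]; exact hx.ne)
  rwa [sub_add_cancel, norm_one, max_eq_right hx.le] at this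

lemma norm_mul_sub_one_lt {x y : K} (hx : ‖x - 1‖ < 1) (hy : ‖y - 1‖ < 1) : ‖x * y - 1‖ < 1 := by
  have : x * y - 1 = x * (y - 1) + (x - 1) := by ring
  rw [this]
  refine (IsUltrametricDist.norm_add_le_max _ _).trans_lt (max_lt ?_ hx)
  rwa [norm_mul, norm_eq_one_of_norm_sub_one_lt hx, one_mul]

lemma norm_prod_pow_sub_one_lt {ι : Type*} (s : Finset ι) (x : ι → K) (w : ι → ℕ)
    (hx : ∀ i ∈ s, ‖x i - 1‖ < 1) : ‖∏ i ∈ s, x i ^ w i - 1‖ < 1 := by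
  refine Finset.prod_induction (fun i => x i ^ w i) (fun y => ‖y - 1‖ < 1)
    (fun _ _ => norm_mul_sub_one_lt) (by simp) fun i hi => ?_
  induction w i with
  | zero => simp
  | succ k ih =>
    rw [pow_succ]
    exact norm_mul_sub_one_lt ih (hx i hi)

lemma norm_mul_sub_eq_one {u e e' : K} (hu : ‖u‖ = 1) (hu1 : ‖u - 1‖ = 1) (he : ‖e - 1‖ < 1)
    (he' : ‖e' - 1‖ < 1) : ‖u * e - e'‖ = 1 := by
  have h : u * e - e' = (u * (e - 1) + (1 - e')) + (u - 1) := by ring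
  have h1 : ‖u * (e - 1) + (1 - e')‖ < 1 := by
    refine (IsUltrametricDist.norm_add_le_max _ _).trans_lt (max_lt ?_ ?_)
    · rwa [norm_mul, hu, one_mul]
    · rwa [norm_sub_rev]
  rw [h, IsUltrametricDist.norm_add_eq_max_of_norm_ne_norm (by rw [hu1]; exact h1.ne), hu1,
    max_eq_right h1.le]

end Circle

/-! ### A tropically generic system with chain supports and many valuation vectors -/

section ChainSystem

variable {p : ℕ} [hp : Fact p.Prime] {n : ℕ}

/-- The linear factors `1 + p ^ (2 i + 1) z`. -/
def chainFactor (p : ℕ) [Fact p.Prime] (i : ℕ) (z : ℂ_[p]) : ℂ_[p] :=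
  1 + (p : ℂ_[p]) ^ (2 * i + 1) * z

/-- The system `x_i x_{i+1} = 1 + p ^ (2 i + 1) x_0 ^ 2`. -/
def chainSystem (p : ℕ) [Fact p.Prime] (hn : 1 ≤ n) (i : Fin n) : LaurentPoly p n :=
  AddMonoidAlgebra.single (chainExponent i) 1 - (AddMonoidAlgebra.single 0 1 +
    AddMonoidAlgebra.single (Pi.single ⟨0, hn⟩ 2) ((p : ℂ_[p]) ^ (2 * i.val + 1)))

lemma evalAt_chainSystem (hn : 1 ≤ n) (i : Fin n) (x : Fin n → ℂ_[p]) :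
    (chainSystem p hn i).evalAt x =
      monomialValue x (chainExponent i) - chainFactor p i (x ⟨0, hn⟩ ^ 2) := by
  rw [← LaurentPoly.evalLin_apply, chainSystem, map_sub, map_add, LaurentPoly.evalLin_single,
    LaurentPoly.evalLin_single, LaurentPoly.evalLin_single, monomialValue_zero,
    monomialValue_single, chainFactor, one_mul, one_mul]
  rfl

lemma evalAt_chainSystem_eq_zero_iff (hn : 1 ≤ n) (i : Fin n) (x : Fin n → ℂ_[p]) :
    (chainSystem p hn i).evalAt x = 0 ↔
      monomialValue x (chainExponent i) = chainFactor p i (x ⟨0, hn⟩ ^ 2) := by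
  rw [evalAt_chainSystem, sub_eq_zero]

lemma supp_chainSystem_subset (hn : 1 ≤ n) (i : Fin n) :
    (chainSystem p hn i).supp ⊆ (chainSupports n i : Set (Fin n → ℤ)) := by
  classical
  intro c hc
  by_contra hcA
  simp only [chainSupports, Finset.coe_insert, Finset.coe_singleton, Set.mem_insert_iff,
    Set.mem_singleton_iff, not_or] at hcA
  have h0 : (0 : Fin n → ℤ) ≠ c := fun h => hcA.1 h.symm
  have h1 : (Pi.single ⟨0, hn⟩ 2 : Fin n → ℤ) ≠ c := fun h => hcA.2.1 h.symm
  have h2 : chainExponent i ≠ c := fun h => hcA.2.2 h.symm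
  refine hc ?_
  change (Finsupp.single (chainExponent i) (1 : ℂ_[p]) - (Finsupp.single 0 1 +
    Finsupp.single (Pi.single ⟨0, hn⟩ 2) ((p : ℂ_[p]) ^ (2 * i.val + 1))) :
      (Fin n → ℤ) →₀ ℂ_[p]) c = 0
  simp [h0, h1, h2]

open Polynomial in
/-- The polynomial satisfied by `x_0 ^ 2` for the roots of the system. -/
def chainResultant (p : ℕ) [Fact p.Prime] (n : ℕ) : Polynomial ℂ_[p] :=
  X * ∏ i ∈ Finset.range n, (1 + C ((p : ℂ_[p]) ^ (2 * i + 1)) * X) ^ oddWeight i -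
    ∏ i ∈ Finset.range n, (1 + C ((p : ℂ_[p]) ^ (2 * i + 1)) * X) ^ evenWeight i

lemma eval_chainResultant (z : ℂ_[p]) : (chainResultant p n).eval z =
    z * ∏ i ∈ Finset.range n, chainFactor p i z ^ oddWeight i -
      ∏ i ∈ Finset.range n, chainFactor p i z ^ evenWeight i := by
  simp [chainResultant, chainFactor, Polynomial.eval_prod]

lemma chainResultant_ne_zero : chainResultant p n ≠ 0 := by
  intro h
  have := eval_chainResultant (p := p) (n := n) 0
  rw [h] at this
  simp [chainFactor] at this

lemma prod_extendBy_chainFactor (z : ℂ_[p]) (w : ℕ → ℕ) :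
    ∏ i ∈ Finset.range n, extendBy 1 (fun i : Fin n => chainFactor p i z) i ^ w i =
      ∏ i ∈ Finset.range n, chainFactor p i z ^ w i := by
  refine Finset.prod_congr rfl fun i hi => ?_
  have := extendBy_coe 1 (fun i : Fin n => chainFactor p i z) ⟨i, Finset.mem_range.1 hi⟩
  rw [this]

lemma finite_torusZeros_chainSystem (hn : 1 ≤ n) : (torusZeros (chainSystem p hn)).Finite := by
  classical
  refine Set.Finite.of_injOn (f := fun x => x ⟨0, hn⟩ ^ 2)
    (t := ((chainResultant p n).roots.toFinset : Set ℂ_[p])) ?_ ?_ (Finset.finite_toSet _)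
  · rintro x ⟨hx, hxF⟩
    have hmon := fun i => (evalAt_chainSystem_eq_zero_iff hn i x).1 (hxF i)
    rw [Finset.mem_coe, Multiset.mem_toFinset, Polynomial.mem_roots chainResultant_ne_zero,
      Polynomial.IsRoot, eval_chainResultant, sub_eq_zero]
    have := chain_relation hn hx
    simp only [hmon, prod_extendBy_chainFactor, monomialValue_single] at this
    exact this.symm
  · rintro x ⟨hx, hxF⟩ y ⟨hy, hyF⟩ hxy
    refine eq_of_chain_eq hx hy fun i => ?_
    rw [(evalAt_chainSystem_eq_zero_iff hn i x).1 (hxF i),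
      (evalAt_chainSystem_eq_zero_iff hn i y).1 (hyF i)]
    exact congrArg _ hxy

lemma norm_prime_pow (k : ℕ) : ‖(p : ℂ_[p]) ^ k‖ = ((p : ℝ)⁻¹) ^ k := by
  rw [norm_pow, norm_natCast_prime]

lemma inv_prime_pos : (0 : ℝ) < (p : ℝ)⁻¹ := inv_pos.2 (zero_lt_one.trans one_lt_natCast_prime)

lemma inv_prime_lt_one : (p : ℝ)⁻¹ < 1 := inv_lt_one_of_one_lt₀ one_lt_natCast_prime

/-- The dominating term of `1 + p ^ (2 i + 1) z` on the circle `‖z‖ = p ^ (2 k)`. -/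
def dominatingTerm (p : ℕ) [Fact p.Prime] (k : ℕ) (u : ℂ_[p]) (i : ℕ) : ℂ_[p] :=
  ((p : ℂ_[p])⁻¹) ^ (k - i) * u ^ ((k - i) % 2) *
    (((p : ℂ_[p])⁻¹) ^ (k - (i + 1)) * u ^ ((k - (i + 1)) % 2))

lemma dominatingTerm_of_lt {k i : ℕ} (h : i < k) (u : ℂ_[p]) :
    dominatingTerm p k u i = (p : ℂ_[p]) ^ (2 * i + 1) * (((p : ℂ_[p])⁻¹) ^ (2 * k) * u) := by
  obtain ⟨d, rfl⟩ : ∃ d, k = i + 1 + d := ⟨k - (i + 1), by omega⟩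
  have h1 : i + 1 + d - i = d + 1 := by omega
  have h2 : i + 1 + d - (i + 1) = d := by omega
  have h3 : u ^ ((d + 1) % 2) * u ^ (d % 2) = u := by
    rw [← pow_add]
    have : (d + 1) % 2 + d % 2 = 1 := by omega
    rw [this, pow_one]
  have h4 : 2 * (i + 1 + d) = (2 * i + 1) + (d + 1 + d) := by omega
  have hp0 : (p : ℂ_[p]) ≠ 0 := natCast_prime_ne_zero
  rw [dominatingTerm, h1, h2, h4, pow_add _ (2 * i + 1), pow_add _ (d + 1)]
  have h5 : (p : ℂ_[p]) ^ (2 * i + 1) * ((p : ℂ_[p])⁻¹) ^ (2 * i + 1) = 1 := by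
    rw [← mul_pow, mul_inv_cancel₀ hp0, one_pow]
  linear_combination ((p : ℂ_[p])⁻¹) ^ (d + 1) * ((p : ℂ_[p])⁻¹) ^ d * h3 -
    ((p : ℂ_[p])⁻¹) ^ (d + 1) * ((p : ℂ_[p])⁻¹) ^ d * u * h5

lemma dominatingTerm_of_le {k i : ℕ} (h : k ≤ i) (u : ℂ_[p]) : dominatingTerm p k u i = 1 := by
  have h1 : k - i = 0 := by omega
  have h2 : k - (i + 1) = 0 := by omega
  simp [dominatingTerm, h1, h2]

lemma norm_dominatingTerm {u : ℂ_[p]} (hu : ‖u‖ = 1) (k i : ℕ) :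
    ‖dominatingTerm p k u i‖ = ‖dominatingTerm p k 1 i‖ := by
  simp [dominatingTerm, hu]

lemma norm_shifted {u : ℂ_[p]} (hu : ‖u‖ = 1) (k i : ℕ) :
    ‖(p : ℂ_[p]) ^ (2 * i + 1) * (((p : ℂ_[p])⁻¹) ^ (2 * k) * u)‖ * ((p : ℝ)⁻¹) ^ (2 * k) =
      ((p : ℝ)⁻¹) ^ (2 * i + 1) := by
  have h : ((p : ℂ_[p])⁻¹) ^ (2 * k) * (p : ℂ_[p]) ^ (2 * k) = 1 := by
    rw [← mul_pow, inv_mul_cancel₀ natCast_prime_ne_zero, one_pow]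
  rw [← norm_prime_pow, ← norm_prime_pow, ← norm_mul,
    show (p : ℂ_[p]) ^ (2 * i + 1) * (((p : ℂ_[p])⁻¹) ^ (2 * k) * u) * (p : ℂ_[p]) ^ (2 * k) =
      (p : ℂ_[p]) ^ (2 * i + 1) * u by
        linear_combination (p : ℂ_[p]) ^ (2 * i + 1) * u * h, norm_mul, hu, mul_one]

lemma one_lt_norm_shifted {u : ℂ_[p]} (hu : ‖u‖ = 1) {k i : ℕ} (h : i < k) :
    1 < ‖(p : ℂ_[p]) ^ (2 * i + 1) * (((p : ℂ_[p])⁻¹) ^ (2 * k) * u)‖ := by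
  have h1 := norm_shifted hu k i
  have h2 : ((p : ℝ)⁻¹) ^ (2 * k) < ((p : ℝ)⁻¹) ^ (2 * i + 1) :=
    pow_lt_pow_right_of_lt_one₀ inv_prime_pos inv_prime_lt_one (by omega)
  have h3 : 0 < ((p : ℝ)⁻¹) ^ (2 * k) := pow_pos inv_prime_pos _
  rw [← h1] at h2
  exact (lt_mul_iff_one_lt_left h3).1 h2

lemma norm_shifted_lt_one {u : ℂ_[p]} (hu : ‖u‖ = 1) {k i : ℕ} (h : k ≤ i) :
    ‖(p : ℂ_[p]) ^ (2 * i + 1) * (((p : ℂ_[p])⁻¹) ^ (2 * k) * u)‖ < 1 := by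
  have h1 := norm_shifted hu k i
  have h2 : ((p : ℝ)⁻¹) ^ (2 * i + 1) < ((p : ℝ)⁻¹) ^ (2 * k) :=
    pow_lt_pow_right_of_lt_one₀ inv_prime_pos inv_prime_lt_one (by omega)
  have h3 : 0 < ((p : ℝ)⁻¹) ^ (2 * k) := pow_pos inv_prime_pos _
  rw [← h1] at h2
  exact (mul_lt_iff_lt_one_left h3).1 h2

lemma dominatingTerm_ne_zero {u : ℂ_[p]} (hu : ‖u‖ = 1) (k i : ℕ) : dominatingTerm p k u i ≠ 0 := by
  have h0 : u ≠ 0 := norm_ne_zero_iff.1 (by rw [hu]; exact one_ne_zero)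
  have hp0 : (p : ℂ_[p])⁻¹ ≠ 0 := inv_ne_zero natCast_prime_ne_zero
  exact mul_ne_zero (mul_ne_zero (pow_ne_zero _ hp0) (pow_ne_zero _ h0))
    (mul_ne_zero (pow_ne_zero _ hp0) (pow_ne_zero _ h0))

lemma norm_chainFactor_div_dominatingTerm {u : ℂ_[p]} (hu : ‖u‖ = 1) (k i : ℕ) :
    ‖chainFactor p i (((p : ℂ_[p])⁻¹) ^ (2 * k) * u) / dominatingTerm p k u i - 1‖ < 1 := by
  have h0 := dominatingTerm_ne_zero hu k i
  rcases lt_or_ge i k with h | h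
  · have h1 := one_lt_norm_shifted hu h
    rw [← dominatingTerm_of_lt h] at h1
    rw [chainFactor, ← dominatingTerm_of_lt h, add_div, div_self h0, add_sub_cancel_right,
      norm_div, norm_one]
    exact (div_lt_one (zero_lt_one.trans h1)).2 h1
  · rw [dominatingTerm_of_le h, div_one, chainFactor, add_sub_cancel_left]
    exact norm_shifted_lt_one hu h

lemma prod_chainFactor_eq {u : ℂ_[p]} (hu : ‖u‖ = 1) (k : ℕ) (w : ℕ → ℕ) :
    ∃ e : ℂ_[p], ‖e - 1‖ < 1 ∧
      ∏ i ∈ Finset.range n, chainFactor p i (((p : ℂ_[p])⁻¹) ^ (2 * k) * u) ^ w i =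
        (∏ i ∈ Finset.range n, dominatingTerm p k u i ^ w i) * e := by
  refine ⟨_, norm_prod_pow_sub_one_lt (Finset.range n) _ w fun i _ =>
    norm_chainFactor_div_dominatingTerm hu k i, ?_⟩
  rw [← Finset.prod_mul_distrib]
  refine Finset.prod_congr rfl fun i _ => ?_
  rw [← mul_pow, mul_div_cancel₀ _ (dominatingTerm_ne_zero hu k i)]

/-- The values of the resultant polynomial on the circle `‖z‖ = p ^ (2 k)`. -/
lemma eval_chainResultant_circle {u : ℂ_[p]} (hu : ‖u‖ = 1) {k : ℕ} (hk : k ≤ n) :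
    ∃ e e' : ℂ_[p], ‖e - 1‖ < 1 ∧ ‖e' - 1‖ < 1 ∧
      (chainResultant p n).eval (((p : ℂ_[p])⁻¹) ^ (2 * k) * u) =
        (∏ i ∈ Finset.range n, dominatingTerm p k u i ^ evenWeight i) *
          ((if Even k then u else u⁻¹) * e - e') := by
  have hu0 : u ≠ 0 := norm_ne_zero_iff.1 (by rw [hu]; exact one_ne_zero)
  obtain ⟨e, he, heq⟩ := prod_chainFactor_eq (n := n) hu k oddWeight
  obtain ⟨e', he', heq'⟩ := prod_chainFactor_eq (n := n) hu k evenWeight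
  refine ⟨e, e', he, he', ?_⟩
  have htel := prod_chain_telescope
    (fun i => ((p : ℂ_[p])⁻¹) ^ (k - i) * u ^ ((k - i) % 2)) n
  have hkn : k - n = 0 := by omega
  simp only [hkn, pow_zero, Nat.zero_mod, mul_one, one_pow, ite_self, Nat.sub_zero] at htel
  change (∏ i ∈ Finset.range n, dominatingTerm p k u i ^ evenWeight i) =
    _ * (∏ i ∈ Finset.range n, dominatingTerm p k u i ^ oddWeight i) at htel
  rw [eval_chainResultant, heq, heq', htel]
  by_cases h : Even k
  · rw [if_pos h, Nat.even_iff.1 h]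
    ring
  · rw [if_neg h, Nat.not_even_iff.1 h]
    field_simp
    ring

lemma exists_root_chainResultant {k : ℕ} (hk : k ≤ n) :
    ∃ u : ℂ_[p], ‖u‖ = 1 ∧ (chainResultant p n).eval (((p : ℂ_[p])⁻¹) ^ (2 * k) * u) = 0 := by
  obtain ⟨u, hu, hu1⟩ := exists_norm_eq_one_and_norm_sub_one_eq_one ℂ_[p]
  have hp0 : ((p : ℂ_[p])⁻¹) ^ (2 * k) ≠ 0 := pow_ne_zero _ (inv_ne_zero natCast_prime_ne_zero)
  obtain ⟨ζ, hζ, hζn⟩ := exists_root_of_norm_eval_ne (P := chainResultant p n)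
    (z₁ := ((p : ℂ_[p])⁻¹) ^ (2 * k) * 1) (z₂ := ((p : ℂ_[p])⁻¹) ^ (2 * k) * u)
    (by rw [norm_mul, norm_mul, hu, norm_one]) (by
      obtain ⟨e, e', he, he', h⟩ := eval_chainResultant_circle (p := p) norm_one hk
      obtain ⟨d, d', hd, hd', h'⟩ := eval_chainResultant_circle hu hk
      rw [h, h', norm_mul, norm_mul]
      have hb : ‖∏ i ∈ Finset.range n, dominatingTerm p k u i ^ evenWeight i‖ =
          ‖∏ i ∈ Finset.range n, dominatingTerm p k 1 i ^ evenWeight i‖ := by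
        rw [norm_prod, norm_prod]
        exact Finset.prod_congr rfl fun i _ => by
          rw [norm_pow, norm_pow, norm_dominatingTerm hu]
      have hb0 : ‖∏ i ∈ Finset.range n, dominatingTerm p k 1 i ^ evenWeight i‖ ≠ 0 :=
        norm_ne_zero_iff.2 (Finset.prod_ne_zero_iff.2 fun i _ =>
          pow_ne_zero _ (dominatingTerm_ne_zero norm_one k i))
      rw [hb]
      refine fun heq => absurd (mul_left_cancel₀ hb0 heq) (ne_of_lt ?_)
      have h1 : ‖(if Even k then u else u⁻¹) * d - d'‖ = 1 := by
        refine norm_mul_sub_eq_one ?_ ?_ hd hd'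
        · split_ifs
          · exact hu
          · rw [norm_inv, hu, inv_one]
        · split_ifs
          · exact hu1
          · have hu0 : u ≠ 0 := norm_ne_zero_iff.1 (by rw [hu]; exact one_ne_zero)
            have : u⁻¹ - 1 = -(u - 1) / u := by field_simp; ring
            rw [this, norm_div, norm_neg, hu1, hu, div_one]
      rw [h1, inv_one, ite_self, one_mul]
      refine norm_sub_lt_of_ultrametric he ?_
      rwa [norm_sub_rev])
  refine ⟨ζ / ((p : ℂ_[p])⁻¹) ^ (2 * k), ?_, ?_⟩
  · rw [norm_div, hζn, mul_one, div_self (norm_ne_zero_iff.2 hp0)]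
  · rwa [mul_div_cancel₀ _ hp0]

lemma exists_mem_valuationVectors_chainSystem (hn : 1 ≤ n) {k : ℕ} (hk : k ≤ n) :
    ∃ w ∈ valuationVectors (chainSystem p hn), w ⟨0, hn⟩ = -k := by
  obtain ⟨u, hu, hroot⟩ := exists_root_chainResultant (p := p) hk
  set z := ((p : ℂ_[p])⁻¹) ^ (2 * k) * u with hz
  have hfac : ∀ i : Fin n, chainFactor p i z ≠ 0 := by
    intro i h
    have := norm_chainFactor_div_dominatingTerm hu k i
    rw [← hz, h] at this
    simp at this
  rw [eval_chainResultant, sub_eq_zero] at hroot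
  obtain ⟨x, hx, hxY, hx0⟩ := exists_point_of_chain hn hfac (Z := z) (by
    rw [prod_extendBy_chainFactor, prod_extendBy_chainFactor, hroot])
  rw [monomialValue_single] at hx0
  have hx0' : x ⟨0, hn⟩ ^ 2 = z := hx0
  refine ⟨ordVec x, ⟨x, ⟨hx, fun i => ?_⟩, rfl⟩, ?_⟩
  · rw [evalAt_chainSystem_eq_zero_iff, hxY, hx0']
  · have hu0 : u ≠ 0 := norm_ne_zero_iff.1 (by rw [hu]; exact one_ne_zero)
    have hou : ordC p u = 0 := by
      rw [← ordC_one (p := p), ordC_eq_iff hu0 one_ne_zero, hu, norm_one]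
    have h1 := congrArg (ordC p) hx0'
    rw [ordC_pow, hz, ordC_mul (pow_ne_zero _ (inv_ne_zero natCast_prime_ne_zero)) hu0, hou,
      ordC_pow, ordC_inv, ordC_natCast_prime] at h1
    push_cast at h1
    change ordC p (x ⟨0, hn⟩) = -k
    linarith

lemma le_encard_valuationVectors_chainSystem (hn : 1 ≤ n) :
    ((n + 1 : ℕ) : ℕ∞) ≤ (valuationVectors (chainSystem p hn)).encard := by
  choose w hw hwk using fun k : Fin (n + 1) =>
    exists_mem_valuationVectors_chainSystem (p := p) hn (Nat.lt_succ_iff.1 k.2)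
  have hinj : Function.Injective w := by
    intro k l hkl
    have h1 := hwk k
    rw [hkl, hwk l, neg_inj] at h1
    exact Fin.ext (by exact_mod_cast h1.symm)
  have h1 := Set.encard_le_encard (Set.range_subset_iff.2 hw)
  rw [← Set.image_univ, hinj.encard_image, Set.encard_univ, ENat.card_eq_coe_fintype_card,
    Fintype.card_fin] at h1
  exact h1

end ChainSystem

end

noncomputable section

/-! ### Tropical genericity of the chain system -/

section ChainGeneric

variable {p : ℕ} [hp : Fact p.Prime] {n : ℕ}

lemma pairing_add (a b : Fin n → ℤ) (w : Fin n → ℝ) :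
    pairing (a + b) w = pairing a w + pairing b w := by
  simp [pairing_apply, add_mul, Finset.sum_add_distrib]

lemma pairing_single (i : Fin n) (k : ℤ) (w : Fin n → ℝ) :
    pairing (Pi.single i k) w = k * w i := by
  rw [pairing_apply, Finset.sum_eq_single i]
  · simp
  · intro j _ hj; simp [hj]
  · simp

lemma pairing_chainExponent (i : Fin n) (w : Fin n → ℝ) :
    pairing (chainExponent i) w = extendBy 0 w i + extendBy 0 w (i + 1) := by
  rw [chainExponent, pairing_add, pairing_single, extendBy_coe, Int.cast_one, one_mul, extendBy]
  split_ifs with h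
  · rw [pairing_single, Int.cast_one, one_mul]
  · simp [pairing_apply]

/-- The valuation of the last term of the `i`-th equation of the chain system. -/
def chainLevel (hn : 1 ≤ n) (i : ℕ) (w : Fin n → ℝ) : ℝ := 2 * w ⟨0, hn⟩ + (2 * i + 1)

lemma ordC_prime_pow_mul (i : ℕ) {x : ℂ_[p]} (hx : x ≠ 0) :
    ordC p ((p : ℂ_[p]) ^ (2 * i + 1) * x ^ 2) = 2 * ordC p x + (2 * i + 1) := by
  rw [ordC_mul (pow_ne_zero _ natCast_prime_ne_zero) (pow_ne_zero _ hx), ordC_pow, ordC_pow,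
    ordC_natCast_prime]
  push_cast
  ring

lemma norm_lt_one_iff_ordC {x : ℂ_[p]} (hx : x ≠ 0) : ‖x‖ < 1 ↔ 0 < ordC p x := by
  rw [← ordC_one (p := p), ordC_lt_iff one_ne_zero hx, norm_one]

lemma one_lt_norm_iff_ordC {x : ℂ_[p]} (hx : x ≠ 0) : 1 < ‖x‖ ↔ ordC p x < 0 := by
  rw [← ordC_one (p := p), ordC_lt_iff hx one_ne_zero, norm_one]

lemma ordC_one_add_of_pos {y : ℂ_[p]} (hy : y ≠ 0) (h : 0 < ordC p y) :
    1 + y ≠ 0 ∧ ordC p (1 + y) = 0 := by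
  have h1 : ‖1 + y‖ = 1 := norm_eq_one_of_norm_sub_one_lt (by
    rw [add_sub_cancel_left]; exact (norm_lt_one_iff_ordC hy).2 h)
  have h0 : 1 + y ≠ 0 := norm_ne_zero_iff.1 (by rw [h1]; exact one_ne_zero)
  exact ⟨h0, by rw [← ordC_one (p := p), ordC_eq_iff h0 one_ne_zero, h1, norm_one]⟩

lemma ordC_one_add_of_neg {y : ℂ_[p]} (hy : y ≠ 0) (h : ordC p y < 0) :
    1 + y ≠ 0 ∧ ordC p (1 + y) = ordC p y := by
  have h2 := (one_lt_norm_iff_ordC hy).2 h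
  have h1 : ‖1 + y‖ = ‖y‖ := by
    rw [IsUltrametricDist.norm_add_eq_max_of_norm_ne_norm (by rw [norm_one]; exact h2.ne),
      norm_one, max_eq_right h2.le]
  have h0 : 1 + y ≠ 0 := norm_ne_zero_iff.1 (by rw [h1]; exact norm_ne_zero_iff.2 hy)
  exact ⟨h0, (ordC_eq_iff h0 hy).2 h1⟩

lemma ordC_one_add_nonneg {y : ℂ_[p]} (hy : y ≠ 0) (h : ordC p y = 0) (h0 : 1 + y ≠ 0) :
    0 ≤ ordC p (1 + y) := by
  have h1 : ‖y‖ = 1 := by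
    rw [← norm_one (α := ℂ_[p]), ← ordC_eq_iff hy one_ne_zero, h, ordC_one]
  have h2 : ‖1 + y‖ ≤ 1 := (IsUltrametricDist.norm_add_le_max _ _).trans (by
    rw [norm_one, h1, max_self])
  by_contra! hcon
  exact absurd ((one_lt_norm_iff_ordC h0).2 hcon) (not_lt.2 h2)

/-- The valuations of the three terms of the `i`-th equation attain their minimum twice. -/
lemma tropicalSet_chainSystem_subset (hn : 1 ≤ n) (i : Fin n) :
    tropicalSet (chainSystem p hn i) ⊆ {w |
      (pairing (chainExponent i) w = chainLevel hn i w ∧ chainLevel hn i w ≤ 0) ∨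
      (pairing (chainExponent i) w = 0 ∧ 0 ≤ chainLevel hn i w) ∨
      (chainLevel hn i w = 0 ∧ 0 ≤ pairing (chainExponent i) w)} := by
  have hc : Continuous (pairing (chainExponent i)) := LinearMap.continuous_of_finiteDimensional _
  have hl : Continuous (chainLevel hn (n := n) i) := by unfold chainLevel; fun_prop
  refine closure_minimal ?_ (((isClosed_eq hc hl).inter (isClosed_le hl continuous_const)).union
    (((isClosed_eq hc continuous_const).inter (isClosed_le continuous_const hl)).union
      ((isClosed_eq hl continuous_const).inter (isClosed_le continuous_const hc))))
  rintro _ ⟨x, ⟨hx, hxf⟩, rfl⟩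
  have h1 := (evalAt_chainSystem_eq_zero_iff hn i x).1 (hxf ())
  have hx0 := hx ⟨0, hn⟩
  set y := (p : ℂ_[p]) ^ (2 * i.val + 1) * x ⟨0, hn⟩ ^ 2 with hy
  have hy0 : y ≠ 0 := mul_ne_zero (pow_ne_zero _ natCast_prime_ne_zero) (pow_ne_zero _ hx0)
  have hlev : chainLevel hn i (ordVec x) = ordC p y := (ordC_prime_pow_mul i hx0).symm
  have hpair : pairing (chainExponent i) (ordVec x) = ordC p (1 + y) := by
    rw [← ordC_monomialValue_eq_pairing hx, h1]
    rfl
  have hne : 1 + y ≠ 0 := by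
    have := monomialValue_ne_zero hx (chainExponent i)
    rwa [h1] at this
  rw [Set.mem_ofPred_eq, hlev, hpair]
  rcases lt_trichotomy (ordC p y) 0 with h | h | h
  · exact Or.inl ⟨(ordC_one_add_of_neg hy0 h).2, h.le⟩
  · exact Or.inr (Or.inr ⟨h, ordC_one_add_nonneg hy0 h hne⟩)
  · exact Or.inr (Or.inl ⟨(ordC_one_add_of_pos hy0 h).2, h.le⟩)

lemma monomialValue_update_one (j : Fin n) (c : ℂ_[p]) (a : Fin n → ℤ) :
    monomialValue (Function.update (1 : Fin n → ℂ_[p]) j c) a = c ^ a j := by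
  rw [monomialValue, Finset.prod_eq_single j]
  · rw [Function.update_self]
  · intro k _ hk
    rw [Function.update_of_ne hk, Pi.one_apply, one_zpow]
  · simp

lemma exists_chainExponent_eq_one (hn : 2 ≤ n) (i : Fin n) :
    ∃ j : Fin n, j ≠ ⟨0, by omega⟩ ∧ chainExponent i j = 1 := by
  by_cases hi : i = ⟨0, by omega⟩
  · refine ⟨⟨1, by omega⟩, by simp, ?_⟩
    subst hi
    have h : 0 + 1 < n := by omega
    simp [chainExponent, h]
  · exact ⟨i, hi, chainExponent_apply_self i⟩

/-- Points of the tropical hypersurface of an equation of the chain system. -/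
lemma mem_tropicalSet_chainSystem (hn : 2 ≤ n) (i : Fin n) {w : Fin n → ℝ}
    (hw : chainLevel (by omega) i w ≠ 0)
    (h : pairing (chainExponent i) w = min 0 (chainLevel (by omega) i w)) :
    w ∈ tropicalSet (chainSystem p (by omega) i) := by
  have hn1 : 1 ≤ n := by omega
  obtain ⟨j, hj0, hj⟩ := exists_chainExponent_eq_one hn i
  have hc : Continuous (pairing (chainExponent i)) := LinearMap.continuous_of_finiteDimensional _
  have hl : Continuous (chainLevel hn1 (n := n) i) := by unfold chainLevel; fun_prop
  refine mem_tropicalSet_of_continuousAt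
    (fun u => u + Pi.single j (min 0 (chainLevel hn1 i u) - pairing (chainExponent i) u))
    (Continuous.continuousAt ?_) ?_ ?_
  · exact continuous_id.add ((continuous_single j).comp ((continuous_const.min hl).sub hc))
  · simp only [h, sub_self, Pi.single_zero, add_zero]
  · filter_upwards [hl.continuousAt.eventually_ne hw] with u hu x hx hxu
    have hx0 := hx ⟨0, hn1⟩
    set y := (p : ℂ_[p]) ^ (2 * i.val + 1) * x ⟨0, hn1⟩ ^ 2 with hy
    have hy0 : y ≠ 0 := mul_ne_zero (pow_ne_zero _ natCast_prime_ne_zero) (pow_ne_zero _ hx0)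
    have hlev : chainLevel hn1 i u = ordC p y := by
      rw [← hxu]; exact (ordC_prime_pow_mul i hx0).symm
    have hpair : pairing (chainExponent i) u = ordC p (monomialValue x (chainExponent i)) := by
      rw [ordC_monomialValue_eq_pairing hx, hxu]
    have hfac : 1 + y ≠ 0 ∧ ordC p (1 + y) = min 0 (chainLevel hn1 i u) := by
      rw [hlev] at hu ⊢
      rcases lt_or_gt_of_ne hu with h1 | h1
      · rw [min_eq_right h1.le]; exact ordC_one_add_of_neg hy0 h1
      · rw [min_eq_left h1.le]; exact ordC_one_add_of_pos hy0 h1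
    have hm := monomialValue_ne_zero hx (chainExponent i)
    set c := (1 + y) / monomialValue x (chainExponent i) with hcdef
    have hc0 : c ≠ 0 := div_ne_zero hfac.1 hm
    have hne : ∀ k, (x * Function.update (1 : Fin n → ℂ_[p]) j c) k ≠ 0 := by
      intro k
      refine mul_ne_zero (hx k) ?_
      by_cases hk : k = j
      · rw [hk, Function.update_self]; exact hc0
      · rw [Function.update_of_ne hk]; exact one_ne_zero
    refine ⟨x * Function.update (1 : Fin n → ℂ_[p]) j c, hne, ?_, ?_⟩
    · rw [evalAt_chainSystem_eq_zero_iff, monomialValue_mul, monomialValue_update_one, hj, zpow_one,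
        hcdef, mul_div_cancel₀ _ hm, Pi.mul_apply, Function.update_of_ne (Ne.symm hj0),
        Pi.one_apply, mul_one]
      rfl
    · ext k
      by_cases hk : k = j
      · subst hk
        simp only [ordVec, Pi.mul_apply, Function.update_self, Pi.add_apply, Pi.single_eq_same]
        rw [ordC_mul (hx k) hc0, hcdef, ordC_div hfac.1 hm, hfac.2, hpair, ← hxu]
        rfl
      · simp only [ordVec, Pi.mul_apply, Function.update_of_ne hk, Pi.one_apply, mul_one,
          Pi.add_apply, Pi.single_eq_of_ne hk, add_zero]
        rw [← hxu]
        rfl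

lemma eq_zero_of_chain_sums {x : ℕ → ℝ} {n j : ℕ} (hn : x n = 0)
    (h : ∀ i, j ≤ i → i < n → x i + x (i + 1) = 0) {i : ℕ} (hj : j ≤ i) (hi : i ≤ n) : x i = 0 := by
  revert hj
  induction hi using Nat.decreasingInduction with
  | self => exact fun _ => hn
  | of_succ k hk ih =>
    intro hj
    have h1 := h k hj hk
    rw [ih (by omega), add_zero] at h1
    exact h1

lemma eq_zero_of_chain_sums_up {x : ℕ → ℝ} {j : ℕ} (h0 : x 0 = 0)
    (h : ∀ i, i < j → x i + x (i + 1) = 0) {i : ℕ} (hi : i ≤ j) : x i = 0 := by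
  induction i with
  | zero => exact h0
  | succ i ih =>
    have h1 := h i hi
    rw [ih (by omega), zero_add] at h1
    exact h1

/-- At a common point of the tropical hypersurfaces, the last term of every equation either
dominates or is dominated strictly. -/
lemma exists_level_of_common_point (hn : 1 ≤ n) {w : Fin n → ℝ}
    (hw : ∀ i, w ∈ tropicalSet (chainSystem p hn i)) :
    ∃ k ≤ n, ∀ i : Fin n,
      (i.val < k → chainLevel hn i w < 0 ∧ pairing (chainExponent i) w = chainLevel hn i w) ∧
      (k ≤ i.val → 0 < chainLevel hn i w ∧ pairing (chainExponent i) w = 0) := by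
  have htrop := fun i => tropicalSet_chainSystem_subset hn i (hw i)
  have h0 : extendBy 0 w 0 = w ⟨0, hn⟩ := extendBy_coe 0 w ⟨0, hn⟩
  have hneg : ∀ i : Fin n, chainLevel hn i w < 0 →
      pairing (chainExponent i) w = chainLevel hn i w := by
    intro i hi
    rcases htrop i with h | h | h
    · exact h.1
    · exact absurd h.2 (not_le.2 hi)
    · exact absurd h.1 hi.ne
  have hpos : ∀ i : Fin n, 0 < chainLevel hn i w → pairing (chainExponent i) w = 0 := by
    intro i hi
    rcases htrop i with h | h | h
    · exact absurd h.2 (not_le.2 hi)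
    · exact h.1
    · exact absurd h.1 hi.ne'
  have hlev : ∀ i j : ℕ, chainLevel hn i w = chainLevel hn j w + 2 * ((i : ℝ) - j) := by
    intro i j
    simp only [chainLevel]
    ring
  have hne : ∀ j : Fin n, chainLevel hn j w ≠ 0 := by
    intro j hj
    have hge : 0 ≤ pairing (chainExponent j) w := by
      rcases htrop j with h | h | h
      · rw [h.1, hj]
      · rw [h.1]
      · exact h.2
    have hzero : extendBy 0 w (j + 1) = 0 := by
      refine eq_zero_of_chain_sums (n := n) (j := j + 1) (extendBy_of_le _ _ le_rfl)
        (fun i hij hin => ?_) le_rfl j.2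
      rw [← pairing_chainExponent ⟨i, hin⟩]
      refine hpos ⟨i, hin⟩ ?_
      rw [hlev i j, hj]
      have : (j : ℝ) + 1 ≤ i := by exact_mod_cast hij
      linarith
    have hup : extendBy 0 w j - ((j : ℝ) - j - 1 / 2) = 0 := by
      refine eq_zero_of_chain_sums_up (x := fun i => extendBy 0 w i - ((i : ℝ) - j - 1 / 2))
        (j := j) ?_ (fun i hij => ?_) le_rfl
      · rw [chainLevel] at hj
        rw [h0]
        push_cast
        linarith
      · have hin : i < n := hij.trans j.2
        have hij' : (i : ℝ) + 1 ≤ j := by exact_mod_cast hij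
        have h1 : chainLevel hn i w = 2 * ((i : ℝ) - j) := by rw [hlev i j, hj, zero_add]
        have h2 := hneg ⟨i, hin⟩ (by rw [h1]; linarith)
        rw [pairing_chainExponent ⟨i, hin⟩] at h2
        simp only [h1] at h2
        push_cast
        linarith
    rw [pairing_chainExponent, hzero] at hge
    linarith
  have hex : ∃ k, ∀ i : Fin n, k ≤ i.val → 0 < chainLevel hn i w :=
    ⟨n, fun i hi => absurd i.2 (not_lt.2 hi)⟩
  classical
  refine ⟨Nat.find hex, Nat.find_min' hex fun i hi => absurd i.2 (not_lt.2 hi), fun i =>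
    ⟨fun hi => ?_, fun hi => ⟨Nat.find_spec hex i hi, hpos i (Nat.find_spec hex i hi)⟩⟩⟩
  have hlt : chainLevel hn i w < 0 := by
    refine lt_of_le_of_ne (not_lt.1 fun hcon => ?_) (hne i)
    refine Nat.find_min hex hi fun l hl => ?_
    rw [hlev l i]
    have : (i : ℝ) ≤ l := by exact_mod_cast hl
    linarith
  exact ⟨hlt, hneg i hlt⟩

lemma tropicallyGeneric_chainSystem (hn : 1 ≤ n) : TropicallyGeneric (chainSystem p hn) := by
  refine intersectTransversally_of_hyperplanes fun w hw => ?_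
  obtain ⟨k, hkn, hk⟩ := exists_level_of_common_point hn hw
  set L : Fin n → (Fin n → ℝ) →ₗ[ℝ] ℝ := fun i => pairing (chainExponent i) -
    if i.val < k then (2 : ℝ) • LinearMap.proj ⟨0, hn⟩ else 0 with hL
  have hLlt : ∀ i : Fin n, i.val < k → ∀ u, L i u =
      pairing (chainExponent i) u - 2 * u ⟨0, hn⟩ := by
    intro i hi u
    simp [hL, hi]
  have hLge : ∀ i : Fin n, k ≤ i.val → ∀ u, L i u = pairing (chainExponent i) u := by
    intro i hi u
    simp [hL, not_lt.2 hi]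
  have hker : ∀ u, (∀ i, L i u = 0) → u = 0 := by
    intro u hu
    have h0 : extendBy 0 u 0 = u ⟨0, hn⟩ := extendBy_coe 0 u ⟨0, hn⟩
    have hhigh : ∀ i, k ≤ i → i ≤ n → extendBy 0 u i = 0 := fun i hki hin =>
      eq_zero_of_chain_sums (n := n) (j := k) (extendBy_of_le _ _ le_rfl) (fun i hki hin => by
        rw [← pairing_chainExponent ⟨i, hin⟩, ← hLge ⟨i, hin⟩ hki]
        exact hu _) hki hin
    have hlow : ∀ i, i ≤ k → extendBy 0 u i - u ⟨0, hn⟩ = 0 := fun i hik =>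
      eq_zero_of_chain_sums_up (x := fun i => extendBy 0 u i - u ⟨0, hn⟩) (j := k)
        (by rw [h0, sub_self]) (fun i hik => by
          have hin : i < n := hik.trans_le hkn
          have h1 := hu ⟨i, hin⟩
          rw [hLlt ⟨i, hin⟩ hik, pairing_chainExponent] at h1
          simp only at h1 ⊢
          linarith) hik
    have hu0 : u ⟨0, hn⟩ = 0 := by
      have h1 := hlow k le_rfl
      rw [hhigh k le_rfl hkn] at h1
      linarith
    ext i
    rw [← extendBy_coe 0 u i]
    rcases le_total i.val k with h | h
    · have := hlow i h
      rw [hu0, sub_zero] at this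
      exact this
    · exact hhigh i h i.2.le
  have hlc : ∀ i, Continuous (chainLevel hn (n := n) i) := by
    intro i; unfold chainLevel; fun_prop
  have hmin : ∀ i : Fin n, ∀ᶠ x in 𝓝 w, chainLevel hn i x ≠ 0 ∧
      (L i (x - w) = 0 ↔ pairing (chainExponent i) x = min 0 (chainLevel hn i x)) := by
    intro i
    rcases lt_or_ge i.val k with h | h
    · obtain ⟨h1, h2⟩ := (hk i).1 h
      filter_upwards [(hlc i).continuousAt.eventually_lt_const h1] with x hx
      refine ⟨hx.ne, ?_⟩
      rw [map_sub, hLlt i h, hLlt i h, min_eq_right hx.le, h2, chainLevel, chainLevel]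
      constructor <;> intro h3 <;> linarith
    · obtain ⟨h1, h2⟩ := (hk i).2 h
      filter_upwards [(hlc i).continuousAt.eventually_const_lt h1] with x hx
      refine ⟨hx.ne', ?_⟩
      rw [map_sub, hLge i h, hLge i h, min_eq_left hx.le, h2, sub_zero]
  refine ⟨L, hker, fun i => ?_⟩
  filter_upwards [hmin i] with x hx
  constructor
  · intro hxT
    rw [hx.2]
    rcases tropicalSet_chainSystem_subset hn i hxT with h | h | h
    · rw [h.1, min_eq_right h.2]
    · rw [h.1, min_eq_left h.2]
    · exact absurd h.1 hx.1
  · intro hxL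
    rcases Nat.lt_or_ge n 2 with h | h
    · have hxw : x - w = 0 := hker _ fun l => by
        have : l = i := Fin.ext (by omega)
        rw [this]; exact hxL
      rw [sub_eq_zero.1 hxw]
      exact hw i
    · exact mem_tropicalSet_chainSystem h i hx.1 (hx.2.1 hxL)

end ChainGeneric

/-! ### The main theorem -/

section Main

variable (p : ℕ) [hp : Fact p.Prime] {n : ℕ}

lemma supp_subset_biUnion {A : Fin n → Finset (Fin n → ℤ)} {F : Fin n → LaurentPoly p n}
    (hF : ∀ i, (F i).supp ⊆ (A i : Set (Fin n → ℤ))) (i : Fin n) :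
    (F i).supp ⊆ ((Finset.univ.biUnion A : Finset (Fin n → ℤ)) : Set (Fin n → ℤ)) :=
  (hF i).trans (Finset.coe_subset.2 (Finset.subset_biUnion_of_mem A (Finset.mem_univ i)))

lemma maxGenericValuations_le_maxValuations (A : Fin n → Finset (Fin n → ℤ)) :
    maxGenericValuations p A ≤ maxValuations p A :=
  biSup_mono fun _ hF => hF.1

lemma maxValuations_eq_zero (hn : 1 ≤ n) {A : Fin n → Finset (Fin n → ℤ)}
    (h : (Finset.univ.biUnion A).card ≤ n) : maxValuations p A = 0 := by
  refine le_antisymm (iSup₂_le fun F hF => ?_) zero_le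
  rw [encard_valuationVectors_eq_zero hn (supp_subset_biUnion p hF.1) hF.2 h]

lemma maxValuations_le_one {A : Fin n → Finset (Fin n → ℤ)}
    (h : (Finset.univ.biUnion A).card = n + 1) : maxValuations p A ≤ 1 :=
  iSup₂_le fun _ hF => encard_valuationVectors_le_one (supp_subset_biUnion p hF.1) hF.2 h

lemma maxGenericValuations_eq_maxValuations {A : Fin n → Finset (Fin n → ℤ)}
    (h : (Finset.univ.biUnion A).card = n + 1) :
    maxGenericValuations p A = maxValuations p A := by
  refine le_antisymm (maxGenericValuations_le_maxValuations p A) (iSup₂_le fun F hF => ?_)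
  rcases (torusZeros F).eq_empty_or_nonempty with h0 | h0
  · simp [valuationVectors, h0]
  · obtain ⟨a, b, ha, hb, hdet⟩ := exists_differenceMatrix_det_ne_zero h hF.1 hF.2 h0
    exact (encard_valuationVectors_le_one (supp_subset_biUnion p hF.1) hF.2 h).trans
      (one_le_maxGenericValuations hdet ha hb)

lemma maxGenericValuations_coordinateSupports (hn : 1 ≤ n) :
    maxGenericValuations p (coordinateSupports n) = 1 :=
  le_antisymm ((maxGenericValuations_le_maxValuations p _).trans
    (maxValuations_le_one p (card_biUnion_coordinateSupports hn)))
    (one_le_maxGenericValuations det_differenceMatrix_coordinate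
      (fun i => by simp [coordinateSupports]) (fun i => by simp [coordinateSupports]))

lemma maxValuations_le_of_inGeneralPosition (hn : 1 ≤ n) {A : Fin n → Finset (Fin n → ℤ)}
    (h : (Finset.univ.biUnion A).card = n + 2) (hA : InGeneralPosition (Finset.univ.biUnion A)) :
    maxValuations p A ≤ ((max 2 ((n / 2) ^ n + n) : ℕ) : ℕ∞) := by
  refine iSup₂_le fun F hF => ?_
  refine (encard_valuationVectors_le_add_one (supp_subset_biUnion p hF.1) hF.2 h hA).trans ?_
  exact_mod_cast add_one_le_max_div_two_pow hn

lemma maxGenericValuations_chainSupports (hn : 1 ≤ n) :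
    maxGenericValuations p (chainSupports n) = ((n + 1 : ℕ) : ℕ∞) := by
  refine le_antisymm (iSup₂_le fun F hF => ?_) ?_
  · refine (Set.encard_image_le _ _).trans ?_
    exact_mod_cast encard_torusZeros_chain_le hn
      (fun i => (hF.1.1 i).trans (Finset.coe_subset.2 (chainSupports_subset hn i))) hF.1.2
  · exact (le_encard_valuationVectors_chainSystem hn).trans
      (le_iSup₂ (f := fun F _ => (valuationVectors F).encard) (chainSystem p hn)
        ⟨⟨supp_chainSystem_subset hn, finite_torusZeros_chainSystem hn⟩,
          tropicallyGeneric_chainSystem hn⟩)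

end Main

end

theorem theorem1p6 (p : ℕ) [Fact p.Prime] (n : ℕ) (hn : 1 ≤ n)
    (A : Fin n → Finset (Fin n → ℤ)) :
    ((Finset.univ.biUnion A).card ≤ n →
      maxGenericValuations p A = 0 ∧ maxValuations p A = 0) ∧
    ((Finset.univ.biUnion A).card = n + 1 →
      maxGenericValuations p A = maxValuations p A ∧ maxValuations p A ≤ 1) ∧
    maxGenericValuations p (coordinateSupports n) = 1 ∧
    ((Finset.univ.biUnion A).card = n + 2 → InGeneralPosition (Finset.univ.biUnion A) →
      maxValuations p A ≤ ((max 2 ((n / 2) ^ n + n) : ℕ) : ℕ∞)) ∧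
    maxGenericValuations p (chainSupports n) = ((n + 1 : ℕ) : ℕ∞) := by
  refine ⟨fun h => ⟨?_, maxValuations_eq_zero p hn h⟩,
    fun h => ⟨maxGenericValuations_eq_maxValuations p h, maxValuations_le_one p h⟩,
    maxGenericValuations_coordinateSupports p hn,
    fun h hA => maxValuations_le_of_inGeneralPosition p hn h hA,
    maxGenericValuations_chainSupports p hn⟩
  exact le_antisymm ((maxGenericValuations_le_maxValuations p A).trans
    (maxValuations_eq_zero p hn h).le) zero_le
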